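/- Let $N\in\mathbb N$ and let $\Omega\subset\mathbb R^N$ be open and bounded, with boundary divided into three pairwise disjoint parts, $\partial\Omega=\Gamma_1\cup\Gamma_2\cup\Gamma_3$. Suppose that (i) at each point $x$ of $\Gamma_3$ the boundary is of class $C^1$ (near $x$, $\Omega=\{\rho<0\}$ for a function $\rho$ of class $C^1$ near $x$ with $\rho(x)=0$, $\nabla\rho(x)\ne0$), with outward unit normal $n=\nabla\rho(x)/|\nabla\rho(x)|$, and for some $r>0$ the ball of radius $r$ centred at $x-rn$ is contained in $\Omega$; (ii) the closure of each connected component of $\Omega$ meets $\Gamma_1\cup\Gamma_2$; (iii) the mixed problem $\Delta z=0$ in $\Omega$, $z=0$ on $\Gamma_1$, $z=1$ on $\Gamma_2$, $\partial z/\partial n=0$ on $\Gamma_3$ has a classical solution, that is, a solution $z\in C^2(\Omega)\cap C^0(\overline\Omega)$. (Here and below $\partial/\partial n$ is the one-sided derivative, from inside $\Omega$, in the direction $n$.) Let $u_1,u_2,w_1,w_2\in\mathbb R$ with $w_1<w_2$, let $I$ be the closed interval with end points $u_1$ and $u_2$ (in either order), and let $R=\{(U,w): U\in I,\ w_1\le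 w\le w_2\}$. Let $D\supseteq R$ be a subset of $\mathbb R^2$ (for instance $D=R$), and let $a(U,w)$, $b(U,w)$ be continuous and positive on $D$. Consider the problem $$\nabla\cdot(a(u,w)\nabla u)=0\ \text{in }\Omega,\quad u=u_1\text{ on }\Gamma_1,\quad u=u_2\text{ on }\Gamma_2,\quad \tfrac{\partial u}{\partial n}=0\text{ on }\Gamma_3,$$ $$\nabla\cdot(b(u,w)\nabla w)=0\ \text{in }\Omega,\quad w=w_1\text{ on }\Gamma_1,\quad w=w_2\text{ on }\Gamma_2,\quad \tfrac{\partial w}{\partial n}=0\text{ on }\Gamma_3 .$$ A classical solution is a pair $u,w\in C^1(\Omega)\cap C^0(\overline\Omega)$ with $(u(x),w(x))\in D$ for all $x\in\overline\Omega$, such that the fluxes $a(u,w)\nabla u$ and $b(u,w)\nabla w$ are of class $C^1$ in $\Omega$ and all the above equations and boundary conditions hold pointwise. It is called functional if there is $U\in C^1([w_1,w_2])$ such that $w(x)\in[w_1,w_2]$ and $u(x)=U(w(x))$ for all $x\in\overline\Omega$. Assume that $b/a$ is of class $C^1$ on $R$ and that there are $p,q\in L^1(w_1,w_2)$ such that,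 for almost every $t\in[w_1,w_2]$ and all $U\in I$, $$0\le p(t)\le \frac{b(U,t)}{a(U,t)}\le q(t),\qquad\text{and}\qquad \int_{w_1}^{w_2}p(t)\,dt>0 .$$ Then the problem has at least one functional solution. Moreover, if $b/a$ satisfies on $R$ a Lipschitz condition with respect to $U$, then the functional solution is unique: any two functional solutions $(u,w)$, $(u',w')$ satisfy $u=u'$ and $w=w'$ on $\overline\Omega$. -/

import Mathlib

open Set Topology MeasureTheory

noncomputable section

/-- Divergence of a vector field on `ℝᴺ`. -/
def divergence {N : ℕ} (V : EuclideanSpace ℝ (Fin N) → EuclideanSpace ℝ (Fin N))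
    (x : EuclideanSpace ℝ (Fin N)) : ℝ :=
  ∑ i : Fin N, (fderiv ℝ V x (EuclideanSpace.single i 1)) i

/-- `n` is the outward unit normal of `Ω` at `x`: near `x` the set `Ω` is `{ρ < 0}` for a `C¹`
function `ρ` with `ρ x = 0`, `∇ρ(x) ≠ 0`, and `n = ∇ρ(x) / |∇ρ(x)|`. -/
def IsOutwardUnitNormal {N : ℕ} (Ω : Set (EuclideanSpace ℝ (Fin N)))
    (x n : EuclideanSpace ℝ (Fin N)) : Prop :=
  ∃ ρ : EuclideanSpace ℝ (Fin N) → ℝ, ContDiffAt ℝ 1 ρ x ∧ ρ x = 0 ∧ gradient ρ x ≠ 0 ∧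
    (∀ᶠ y in 𝓝 x, y ∈ Ω ↔ ρ y < 0) ∧ n = ‖gradient ρ x‖⁻¹ • gradient ρ x

/-- A bounded open set `Ω ⊆ ℝᴺ` whose boundary is divided into three parts. The part `Γ₃`, on which
normal derivatives are taken, has an outward normal and an interior tangent ball at each of its
points, and no connected component of `Ω` is bounded by `Γ₃` alone. -/
structure MixedDomain {N : ℕ} (Ω Γ₁ Γ₂ Γ₃ : Set (EuclideanSpace ℝ (Fin N))) : Prop where
  isOpen : IsOpen Ω
  isBounded : Bornology.IsBounded Ω
  union_eq : Γ₁ ∪ Γ₂ ∪ Γ₃ = frontier Ω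
  disjoint₁₂ : Disjoint Γ₁ Γ₂
  disjoint₁₃ : Disjoint Γ₁ Γ₃
  disjoint₂₃ : Disjoint Γ₂ Γ₃
  interior_ball : ∀ x ∈ Γ₃, ∃ n, IsOutwardUnitNormal Ω x n ∧
    ∃ r : ℝ, 0 < r ∧ Metric.ball (x - r • n) r ⊆ Ω
  component_meets : ∀ x ∈ Ω, (closure (connectedComponentIn Ω x) ∩ (Γ₁ ∪ Γ₂)).Nonempty

/-- `v` is continuous on the closure of `Ω`, with `v = c₁` on `Γ₁`, `v = c₂` on `Γ₂` and
`∂v/∂n = 0` on `Γ₃`; the normal derivative is the one-sided derivative from inside `Ω`. -/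
structure MixedBoundaryConditions {N : ℕ} (Ω Γ₁ Γ₂ Γ₃ : Set (EuclideanSpace ℝ (Fin N)))
    (c₁ c₂ : ℝ) (v : EuclideanSpace ℝ (Fin N) → ℝ) : Prop where
  continuousOn : ContinuousOn v (closure Ω)
  dirichlet₁ : ∀ x ∈ Γ₁, v x = c₁
  dirichlet₂ : ∀ x ∈ Γ₂, v x = c₂
  neumann : ∀ x ∈ Γ₃, ∀ n, IsOutwardUnitNormal Ω x n →
    HasDerivWithinAt (fun t : ℝ => v (x + t • n)) 0 (Iic 0) 0

/-- The mixed problem `Δz = 0` in `Ω`, `z = 0` on `Γ₁`, `z = 1` on `Γ₂`, `∂z/∂n = 0` on `Γ₃`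
has a classical solution. -/
def MixedLaplaceSolvable {N : ℕ} (Ω Γ₁ Γ₂ Γ₃ : Set (EuclideanSpace ℝ (Fin N))) : Prop :=
  ∃ z : EuclideanSpace ℝ (Fin N) → ℝ, InnerProductSpace.HarmonicOnNhd z Ω ∧
    MixedBoundaryConditions Ω Γ₁ Γ₂ Γ₃ 0 1 z

/-- `∇·(κ ∇v) = 0` in `Ω` in the classical sense: `v` and the flux `κ ∇v` are of class `C¹` in `Ω`
and the divergence of the flux vanishes. If `κ` is a positive `C¹` function on `Ω`, the regularity
required of `v` is that it be of class `C²`. -/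
structure SolvesDivergenceEq {N : ℕ} (Ω : Set (EuclideanSpace ℝ (Fin N)))
    (κ v : EuclideanSpace ℝ (Fin N) → ℝ) : Prop where
  contDiffOn : ContDiffOn ℝ 1 v Ω
  contDiffOn_flux : ContDiffOn ℝ 1 (fun x => κ x • gradient v x) Ω
  divergence_eq : ∀ x ∈ Ω, divergence (fun x => κ x • gradient v x) x = 0

/-- `(u, w)` is a classical solution of the coupled mixed problem. The coefficients `a`, `b` are
functions on `D`, so `(u, w)` has to take its values there. -/
structure IsClassicalSolution {N : ℕ} (Ω Γ₁ Γ₂ Γ₃ : Set (EuclideanSpace ℝ (Fin N)))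
    (D : Set (ℝ × ℝ)) (a b : ℝ → ℝ → ℝ) (u₁ u₂ w₁ w₂ : ℝ)
    (u w : EuclideanSpace ℝ (Fin N) → ℝ) : Prop where
  mem_domain : ∀ x ∈ closure Ω, (u x, w x) ∈ D
  eq_u : SolvesDivergenceEq Ω (fun x => a (u x) (w x)) u
  bc_u : MixedBoundaryConditions Ω Γ₁ Γ₂ Γ₃ u₁ u₂ u
  eq_w : SolvesDivergenceEq Ω (fun x => b (u x) (w x)) w
  bc_w : MixedBoundaryConditions Ω Γ₁ Γ₂ Γ₃ w₁ w₂ w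

/-- A classical solution is functional if `u = U(w)` for some `U ∈ C¹([w₁, w₂])`. -/
def IsFunctionalSolution {N : ℕ} (Ω Γ₁ Γ₂ Γ₃ : Set (EuclideanSpace ℝ (Fin N)))
    (D : Set (ℝ × ℝ)) (a b : ℝ → ℝ → ℝ) (u₁ u₂ w₁ w₂ : ℝ)
    (u w : EuclideanSpace ℝ (Fin N) → ℝ) : Prop :=
  IsClassicalSolution Ω Γ₁ Γ₂ Γ₃ D a b u₁ u₂ w₁ w₂ u w ∧
    ∃ U : ℝ → ℝ, ContDiffOn ℝ 1 U (Icc w₁ w₂) ∧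
      ∀ x ∈ closure Ω, w x ∈ Icc w₁ w₂ ∧ u x = U (w x)

end

/-!
Let `z` solve the mixed Laplace problem with Dirichlet values `0` and `1`. A functional solution is
a pair of functions of `z`. Indeed, if `u = U(w)`, both fluxes are of the form `c(w) ∇w` with `c`
continuous, namely `c(t) = b(U(t), t)` and `c(t) = a(U(t), t) U'(t)`. The primitives of these `c`,
evaluated at `w`, are therefore harmonic, have constant Dirichlet values and satisfy the Neumann
condition, so that they are multiples of `z`
(`IsClassicalSolution.exists_integral_eq_mul`). Comparing the two, `a(U, t) U' = γ b(U, t)` with a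
constant `γ`: the function `U` solves the boundary value problem `U' = γ b(U, t) / a(U, t)`,
`U(w₁) = u₁`, `U(w₂) = u₂`, in which `γ` is unknown too.

For existence the argument is reversed. As `b/a` is Lipschitz and lies between positive constants on
the rectangle, the boundary value problem is solvable by shooting in the parameter `γ`
(`exists_hasDerivWithinAt_mul_of_contDiffOn`). Its solution is monotone, hence stays in the
rectangle. Then `w` is obtained by inverting the primitive of `b(U(t), t)` at a multiple of `z`, and
`u = U(w)`; this uses `0 ≤ z ≤ 1` (`exists_isFunctionalSolution`).

For uniqueness, two solutions of the boundary value problem with different `γ` start from the same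
point with different slopes, and their difference has a derivative of constant sign at each of its
zeros, so that they do not meet at `w₂`; for equal `γ` the initial value problem has only one
solution (`eqOn_of_hasDerivWithinAt_mul`). The differential equation is known only on the range of
`w`, which is all of `[w₁, w₂]` if `z` takes all values in `[0, 1]`. If it does not, then `z` takes
only the values `0` and `1` (`MixedDomain.range_mixedLaplace`), and both solutions are equal to the
Dirichlet data everywhere.

All this rests on the maximum principle for the mixed Laplace problem
(`MixedDomain.le_of_mixedBoundaryConditions`), which follows from Hopf's boundary point lemma
(`not_hasDerivWithinAt_zero_of_lt_on_ball`): it excludes a maximum on the Neumann part, where there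
is an interior tangent ball, and it also gives the strong maximum principle, by which an interior
maximum spreads over a component to the Dirichlet part. Harmonic functions enter as solutions of
`∇·(1 ∇v) = 0` in the sense of `SolvesDivergenceEq`.
-/

/-! ### Gradient and divergence -/

theorem gradient_apply_eq_fderiv {N : ℕ} (f : EuclideanSpace ℝ (Fin N) → ℝ)
    (x : EuclideanSpace ℝ (Fin N)) (i : Fin N) :
    gradient f x i = fderiv ℝ f x (EuclideanSpace.single i 1) := by
  rw [← toDual_gradient, InnerProductSpace.toDual_apply_apply,
    EuclideanSpace.inner_single_right]
  simp

theorem HasGradientAt.hasDerivAt_line {N : ℕ} {G : EuclideanSpace ℝ (Fin N) → ℝ}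
    {g y e : EuclideanSpace ℝ (Fin N)} {t : ℝ} (h : HasGradientAt G g (y + t • e)) :
    HasDerivAt (fun s : ℝ => G (y + s • e)) (inner ℝ g e) t := by
  have h1 : HasDerivAt (fun s : ℝ => y + s • e) e t := by
    simpa using ((hasDerivAt_id t).smul_const e).const_add y
  have h2 := (hasGradientAt_iff_hasFDerivAt.1 h).comp_hasDerivAt t h1
  rwa [InnerProductSpace.toDual_apply_apply] at h2

/-- The necessary second-order condition `ΔG ≤ 0` at a local maximum, with `ΔG` as the divergence of
the gradient field `V`. -/
theorem divergence_nonpos_of_isLocalMax {N : ℕ} {G : EuclideanSpace ℝ (Fin N) → ℝ}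
    {V : EuclideanSpace ℝ (Fin N) → EuclideanSpace ℝ (Fin N)} {y : EuclideanSpace ℝ (Fin N)}
    (hG : ∀ᶠ x in 𝓝 y, HasGradientAt G (V x) x) (hV : DifferentiableAt ℝ V y)
    (hmax : IsLocalMax G y) : divergence V y ≤ 0 := by
  refine Finset.sum_nonpos fun i _ => ?_
  set e : EuclideanSpace ℝ (Fin N) := EuclideanSpace.single i 1 with he
  set g : ℝ → ℝ := fun s => G (y + s • e) with hg
  have hline : Filter.Tendsto (fun s : ℝ => y + s • e) (𝓝 0) (𝓝 y) := by
    have : Continuous (fun s : ℝ => y + s • e) := by fun_prop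
    simpa using this.tendsto 0
  have hd : ∀ᶠ s in 𝓝 (0 : ℝ), HasDerivAt g (V (y + s • e) i) s := by
    filter_upwards [hline.eventually hG] with s hs
    simpa [he, EuclideanSpace.inner_single_right] using hs.hasDerivAt_line
  have hdd : HasDerivAt (fun s : ℝ => V (y + s • e) i) (fderiv ℝ V y e i) 0 := by
    have h1 : HasDerivAt (fun s : ℝ => y + s • e) e 0 := by
      simpa using ((hasDerivAt_id (0 : ℝ)).smul_const e).const_add y
    have h2 : HasFDerivAt V (fderiv ℝ V y) (y + (0 : ℝ) • e) := by simpa using hV.hasFDerivAt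
    have h3 := h2.comp_hasDerivAt (0 : ℝ) h1
    exact ((EuclideanSpace.proj (𝕜 := ℝ) i).hasFDerivAt.comp_hasDerivAt (0 : ℝ) h3)
  have hderiv : deriv g =ᶠ[𝓝 0] fun s : ℝ => V (y + s • e) i := hd.mono fun s hs => hs.deriv
  have hddg : deriv (deriv g) 0 = fderiv ℝ V y e i := by
    rw [hderiv.deriv_eq, hdd.deriv]
  have hmaxg : IsLocalMax g 0 := by
    have := hline.eventually hmax
    simpa [IsLocalMax, IsMaxFilter, hg] using this
  by_contra hpos
  push Not at hpos
  -- a positive second derivative makes the maximum also a minimum, so `g` is locally constant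
  have hming : IsLocalMin g 0 := isLocalMin_of_deriv_deriv_pos (by rw [hddg]; exact hpos)
    hmaxg.deriv_eq_zero hd.self_of_nhds.continuousAt
  have hconst : g =ᶠ[𝓝 0] fun _ => g 0 := by
    filter_upwards [hmaxg, hming] with s h1 h2 using le_antisymm h1 h2
  have h0 : deriv g =ᶠ[𝓝 0] fun _ => 0 := by
    simpa using hconst.deriv
  rw [← hddg, h0.deriv_eq] at hpos
  simp at hpos

/-- The gradient of the barrier `exp (-α |y - c|²)`. -/
theorem hasGradientAt_exp_neg_mul_normSq {N : ℕ} (α : ℝ) (c y : EuclideanSpace ℝ (Fin N)) :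
    HasGradientAt (fun y => Real.exp (-α * ‖y - c‖ ^ 2))
      ((-2 * α * Real.exp (-α * ‖y - c‖ ^ 2)) • (y - c)) y := by
  rw [hasGradientAt_iff_hasFDerivAt]
  have h1 : HasFDerivAt (fun y : EuclideanSpace ℝ (Fin N) => ‖y - c‖ ^ 2)
      (2 • (innerSL ℝ (y - c))) y := by
    simpa using ((hasFDerivAt_id y).sub_const c).norm_sq
  convert! (h1.const_mul (-α)).exp using 1
  ext v
  simp
  ring

theorem divergence_gradient_exp_neg_mul_normSq {N : ℕ} (α : ℝ) (c y : EuclideanSpace ℝ (Fin N)) :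
    divergence (fun y => (-2 * α * Real.exp (-α * ‖y - c‖ ^ 2)) • (y - c)) y =
      2 * α * (2 * α * ‖y - c‖ ^ 2 - N) * Real.exp (-α * ‖y - c‖ ^ 2) := by
  have h1 : HasFDerivAt (fun y : EuclideanSpace ℝ (Fin N) =>
      -2 * α * Real.exp (-α * ‖y - c‖ ^ 2)) _ y :=
    (hasGradientAt_iff_hasFDerivAt.1 (hasGradientAt_exp_neg_mul_normSq α c y)).const_mul (-2 * α)
  have h2 := h1.smul ((hasFDerivAt_id y).sub_const c)
  have h3 : ‖y - c‖ ^ 2 = ∑ i, (y i - c i) ^ 2 := by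
    simp [EuclideanSpace.norm_sq_eq]
  rw [divergence]
  have h4 : ∀ i : Fin N, (fderiv ℝ (fun y => (-2 * α * Real.exp (-α * ‖y - c‖ ^ 2)) • (y - c)) y
      (EuclideanSpace.single i 1)) i = 2 * α * Real.exp (-α * ‖y - c‖ ^ 2) *
        (2 * α * (y i - c i) ^ 2 - 1) := by
    intro i
    have := h2.fderiv
    simp only [id] at this
    erw [this]
    simp [EuclideanSpace.inner_single_right]
    ring
  rw [Finset.sum_congr rfl fun i _ => h4 i, ← Finset.mul_sum, Finset.sum_sub_distrib,
    ← Finset.mul_sum, ← h3]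
  simp
  ring

theorem divergence_add {N : ℕ} {V W : EuclideanSpace ℝ (Fin N) → EuclideanSpace ℝ (Fin N)}
    {x : EuclideanSpace ℝ (Fin N)} (hV : DifferentiableAt ℝ V x) (hW : DifferentiableAt ℝ W x) :
    divergence (fun y => V y + W y) x = divergence V x + divergence W x := by
  simp [divergence, fderiv_fun_add hV hW, Finset.sum_add_distrib]

theorem divergence_const_smul {N : ℕ} {V : EuclideanSpace ℝ (Fin N) → EuclideanSpace ℝ (Fin N)}
    {x : EuclideanSpace ℝ (Fin N)} (k : ℝ) (hV : DifferentiableAt ℝ V x) :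
    divergence (fun y => k • V y) x = k * divergence V x := by
  simp [divergence, fderiv_fun_const_smul hV, Finset.mul_sum]

theorem divergence_congr {N : ℕ} {V W : EuclideanSpace ℝ (Fin N) → EuclideanSpace ℝ (Fin N)}
    {x : EuclideanSpace ℝ (Fin N)} (h : V =ᶠ[𝓝 x] W) : divergence V x = divergence W x := by
  simp [divergence, h.fderiv_eq]

theorem SolvesDivergenceEq.mono {N : ℕ} {Ω Ω' : Set (EuclideanSpace ℝ (Fin N))}
    {κ v : EuclideanSpace ℝ (Fin N) → ℝ} (h : SolvesDivergenceEq Ω κ v) (hs : Ω' ⊆ Ω) :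
    SolvesDivergenceEq Ω' κ v :=
  ⟨h.1.mono hs, h.2.mono hs, fun x hx => h.3 x (hs hx)⟩

theorem SolvesDivergenceEq.hasGradientAt {N : ℕ} {Ω : Set (EuclideanSpace ℝ (Fin N))}
    (hΩ : IsOpen Ω) {κ v : EuclideanSpace ℝ (Fin N) → ℝ} (h : SolvesDivergenceEq Ω κ v)
    {x : EuclideanSpace ℝ (Fin N)} (hx : x ∈ Ω) : HasGradientAt v (gradient v x) x :=
  ((h.contDiffOn.contDiffAt (hΩ.mem_nhds hx)).differentiableAt one_ne_zero).hasGradientAt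

theorem SolvesDivergenceEq.differentiableAt_gradient {N : ℕ} {Ω : Set (EuclideanSpace ℝ (Fin N))}
    (hΩ : IsOpen Ω) {v : EuclideanSpace ℝ (Fin N) → ℝ} (h : SolvesDivergenceEq Ω (fun _ => 1) v)
    {x : EuclideanSpace ℝ (Fin N)} (hx : x ∈ Ω) : DifferentiableAt ℝ (gradient v) x := by
  have := (h.contDiffOn_flux.contDiffAt (hΩ.mem_nhds hx)).differentiableAt one_ne_zero
  simpa using this

theorem InnerProductSpace.HarmonicOnNhd.solvesDivergenceEq {N : ℕ}
    {Ω : Set (EuclideanSpace ℝ (Fin N))} {z : EuclideanSpace ℝ (Fin N) → ℝ}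
    (h : InnerProductSpace.HarmonicOnNhd z Ω) : SolvesDivergenceEq Ω (fun _ => 1) z := by
  have hgrad : ∀ x ∈ Ω, ContDiffAt ℝ 1 (gradient z) x := by
    intro x hx
    have h1 : ContDiffAt ℝ 1 (fderiv ℝ z) x := (h x hx).1.fderiv_right (by norm_num)
    exact (InnerProductSpace.toDual ℝ (EuclideanSpace ℝ (Fin N))).symm.contDiff.contDiffAt.comp x h1
  refine ⟨fun x hx => ((h x hx).1.of_le (by norm_num)).contDiffWithinAt, fun x hx => ?_,
    fun x hx => ?_⟩
  · simpa using (hgrad x hx).contDiffWithinAt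
  · have h0 := (h x hx).2.self_of_nhds
    rw [InnerProductSpace.laplacian_eq_iteratedFDeriv_orthonormalBasis z
      (EuclideanSpace.basisFun (Fin N) ℝ)] at h0
    simp only [iteratedFDeriv_two_apply, one_smul] at h0 ⊢
    refine Eq.trans (Finset.sum_congr rfl fun i _ => ?_) h0
    have hd : DifferentiableAt ℝ (fderiv ℝ z) x :=
      ((h x hx).1.fderiv_right (m := 1) (by norm_num)).differentiableAt one_ne_zero
    have hg : DifferentiableAt ℝ (gradient z) x := (hgrad x hx).differentiableAt one_ne_zero
    -- both sides are the derivative of `y ↦ ∂ᵢ z y` in the direction `eᵢ`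
    have e1 : HasFDerivAt (fun y => gradient z y i)
        ((EuclideanSpace.proj (𝕜 := ℝ) i).comp (fderiv ℝ (gradient z) x)) x :=
      (EuclideanSpace.proj (𝕜 := ℝ) i).hasFDerivAt.comp x hg.hasFDerivAt
    have e2 : HasFDerivAt (fun y => fderiv ℝ z y (EuclideanSpace.single i 1))
        ((fderiv ℝ (fderiv ℝ z) x).flip (EuclideanSpace.single i 1)) x := by
      simpa using hd.hasFDerivAt.clm_apply (hasFDerivAt_const (EuclideanSpace.single i (1:ℝ)) x)
    simp only [gradient_apply_eq_fderiv] at e1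
    simpa using congrArg (fun L => L (EuclideanSpace.single i 1)) (e1.unique e2)

/-! ### Hopf's lemma -/

/-- **Hopf's boundary point lemma** on a ball: a nonconstant harmonic function that attains its
maximum at a boundary point `x` does not have a vanishing one-sided normal derivative there. -/
theorem not_hasDerivWithinAt_zero_of_lt_on_ball {N : ℕ} {v : EuclideanSpace ℝ (Fin N) → ℝ}
    {x n : EuclideanSpace ℝ (Fin N)} {r M : ℝ} (hr : 0 < r) (hn : ‖n‖ = 1)
    (hv : SolvesDivergenceEq (Metric.ball (x - r • n) r) (fun _ => 1) v)
    (hcont : ContinuousOn v (Metric.closedBall (x - r • n) r))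
    (hlt : ∀ y ∈ Metric.ball (x - r • n) r, v y < M)
    (hle : ∀ y ∈ Metric.closedBall (x - r • n) r, v y ≤ M) (hx : v x = M) :
    ¬ HasDerivWithinAt (fun t : ℝ => v (x + t • n)) 0 (Iic 0) 0 := by
  intro hder
  set c := x - r • n with hc
  obtain ⟨y₁, hy₁, hy₁max⟩ := (isCompact_closedBall c (r / 2)).exists_isMaxOn
    ⟨c, Metric.mem_closedBall_self (by positivity)⟩
    (hcont.mono (Metric.closedBall_subset_closedBall (by linarith)))
  set ε := M - v y₁ with hε
  have hεpos : 0 < ε := sub_pos.2 (hlt y₁ (Metric.closedBall_subset_ball (by linarith) hy₁))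
  -- with this exponent the barrier is strictly subharmonic where `|y - c| > r / 2`
  set α : ℝ := (2 * N + 1) / r ^ 2 with hα
  have hαpos : 0 < α := by positivity
  have hαr : α * r ^ 2 = 2 * N + 1 := by rw [hα]; field_simp
  set G : EuclideanSpace ℝ (Fin N) → ℝ := fun y => v y + ε * Real.exp (-α * ‖y - c‖ ^ 2) with hG
  set A : Set (EuclideanSpace ℝ (Fin N)) := {y | r / 2 ≤ ‖y - c‖} ∩ Metric.closedBall c r with hA
  have hAcomp : IsCompact A := by
    refine (isCompact_closedBall c r).inter_left (isClosed_le continuous_const ?_)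
    fun_prop
  have hGcont : ContinuousOn G A := by
    refine (hcont.mono inter_subset_right).add (Continuous.continuousOn ?_)
    fun_prop
  have hGle : ∀ y ∈ A, G y ≤ M + ε * Real.exp (-α * r ^ 2) := by
    intro y hy
    obtain ⟨y₀, hy₀, hmax⟩ := hAcomp.exists_isMaxOn ⟨y, hy⟩ hGcont
    refine (hmax hy).trans ?_
    have hy₀r : ‖y₀ - c‖ ≤ r := by simpa [dist_eq_norm] using hy₀.2
    rcases eq_or_lt_of_le hy₀r with h | h
    · have := hle y₀ hy₀.2
      simp only [hG, h]
      linarith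
    rcases eq_or_lt_of_le (show r / 2 ≤ ‖y₀ - c‖ from hy₀.1) with h' | h'
    · have h1 : v y₀ ≤ v y₁ := hy₁max (by simp [dist_eq_norm, ← h'])
      have h2 : Real.exp (-α * ‖y₀ - c‖ ^ 2) ≤ 1 := Real.exp_le_one_iff.2 (by
        have := mul_nonneg hαpos.le (sq_nonneg ‖y₀ - c‖)
        linarith)
      have h3 : 0 < ε * Real.exp (-α * r ^ 2) := by positivity
      have h4 : ε * Real.exp (-α * ‖y₀ - c‖ ^ 2) ≤ ε := by nlinarith
      simp only [hG]
      linarith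
    · exfalso
      have hopen : IsOpen ({y | r / 2 < ‖y - c‖} ∩ Metric.ball c r) :=
        (isOpen_lt continuous_const (by fun_prop)).inter Metric.isOpen_ball
      have hmem : y₀ ∈ {y | r / 2 < ‖y - c‖} ∩ Metric.ball c r :=
        ⟨h', by simpa [dist_eq_norm] using h⟩
      have hloc : IsLocalMax G y₀ := by
        filter_upwards [hopen.mem_nhds hmem] with y hy
        exact hmax ⟨le_of_lt (show r / 2 < ‖y - c‖ from hy.1), Metric.ball_subset_closedBall hy.2⟩
      have hVd := hv.differentiableAt_gradient Metric.isOpen_ball hmem.2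
      have hBd : DifferentiableAt ℝ (fun y : EuclideanSpace ℝ (Fin N) =>
          (-2 * α * Real.exp (-α * ‖y - c‖ ^ 2)) • (y - c)) y₀ := by
        have h1 : DifferentiableAt ℝ (fun y : EuclideanSpace ℝ (Fin N) =>
            Real.exp (-α * ‖y - c‖ ^ 2)) y₀ :=
          (hasGradientAt_exp_neg_mul_normSq α c y₀).differentiableAt
        fun_prop
      have hBε : DifferentiableAt ℝ (fun y : EuclideanSpace ℝ (Fin N) =>
          ε • ((-2 * α * Real.exp (-α * ‖y - c‖ ^ 2)) • (y - c))) y₀ := hBd.const_smul ε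
      have hdiv := divergence_nonpos_of_isLocalMax (G := G)
        (V := fun y => gradient v y + ε • ((-2 * α * Real.exp (-α * ‖y - c‖ ^ 2)) • (y - c)))
        (y := y₀) ?_ (hVd.add hBε) hloc
      · rw [divergence_add hVd hBε, divergence_const_smul ε hBd,
          divergence_gradient_exp_neg_mul_normSq] at hdiv
        have h0 : divergence (gradient v) y₀ = 0 := by
          simpa using hv.divergence_eq y₀ hmem.2
        rw [h0, zero_add] at hdiv
        have h1 : (r / 2) ^ 2 < ‖y₀ - c‖ ^ 2 := by gcongr
        have h2 : 0 < 2 * α * ‖y₀ - c‖ ^ 2 - N := by nlinarith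
        have h3 : 0 < ε * (2 * α * (2 * α * ‖y₀ - c‖ ^ 2 - N) *
          Real.exp (-α * ‖y₀ - c‖ ^ 2)) := by positivity
        linarith
      · filter_upwards [hopen.mem_nhds hmem] with y hy
        have h1 := hasGradientAt_iff_hasFDerivAt.1 (hv.hasGradientAt Metric.isOpen_ball hy.2)
        have h2 := hasGradientAt_iff_hasFDerivAt.1 (hasGradientAt_exp_neg_mul_normSq α c y)
        rw [hasGradientAt_iff_hasFDerivAt]
        convert! h1.add (h2.const_mul ε) using 1
        rw [map_add, map_smul]
  have hline : ∀ t : ℝ, x + t • n - c = (r + t) • n := fun t => by rw [hc]; module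
  -- along the normal, `v` plus the barrier has a maximum at `x`, while its derivative is negative
  have hmaxline : IsLocalMaxOn
      (fun t : ℝ => v (x + t • n) + ε * Real.exp (-α * (r + t) ^ 2)) (Iic 0) 0 := by
    have h1 : ∀ᶠ t : ℝ in 𝓝[Iic 0] 0, -(r / 2) < t :=
      nhdsWithin_le_nhds (lt_mem_nhds (by linarith))
    filter_upwards [h1, self_mem_nhdsWithin] with t ht ht0
    have ht0 : t ≤ 0 := ht0
    have hnorm : ‖x + t • n - c‖ = r + t := by
      rw [hline, norm_smul, hn, mul_one, Real.norm_of_nonneg (by linarith)]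
    have := hGle (x + t • n) ⟨by rw [mem_ofPred_eq, hnorm]; linarith,
      by rw [Metric.mem_closedBall, dist_eq_norm, hnorm]; linarith⟩
    simpa [hG, hnorm, hx] using this
  have hexp : HasDerivAt (fun t : ℝ => ε * Real.exp (-α * (r + t) ^ 2))
      (ε * (Real.exp (-α * r ^ 2) * (-α * (2 * r)))) 0 := by
    have h1 : HasDerivAt (fun t : ℝ => -α * (r + t) ^ 2) (-α * (2 * r)) 0 := by
      have := (((hasDerivAt_id (0 : ℝ)).const_add r).pow 2).const_mul (-α)
      simpa using this
    simpa using (h1.exp).const_mul ε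
  have hnonpos := hmaxline.hasFDerivWithinAt_nonpos
    (hder.add hexp.hasDerivWithinAt).hasFDerivWithinAt
    (y := -1) (mem_posTangentConeAt_of_segment_subset (by
      rw [zero_add, segment_symm, segment_eq_Icc (by norm_num)]
      exact fun t ht => ht.2))
  have hpos : 0 < ε * (Real.exp (-α * r ^ 2) * (α * (2 * r))) := by positivity
  simp at hnonpos
  simp at hpos
  linarith

/-! ### The maximum principle -/

/-- The points where a harmonic function attains an interior maximum form an open set. Otherwise the
maximum point nearest to some point of smaller value would contradict Hopf's lemma, since the
gradient vanishes there. -/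
theorem isOpen_setOf_eq_of_le {N : ℕ} {Ω : Set (EuclideanSpace ℝ (Fin N))} (hΩ : IsOpen Ω)
    {v : EuclideanSpace ℝ (Fin N) → ℝ} (hv : SolvesDivergenceEq Ω (fun _ => 1) v) {M : ℝ}
    (hle : ∀ y ∈ Ω, v y ≤ M) : IsOpen {y | y ∈ Ω ∧ v y = M} := by
  have hcont : ContinuousOn v Ω := hv.contDiffOn.continuousOn
  rw [Metric.isOpen_iff]
  rintro y₀ ⟨hy₀, hy₀M⟩
  obtain ⟨ρ, hρ, hball⟩ := Metric.nhds_basis_closedBall.mem_iff.1 (hΩ.mem_nhds hy₀)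
  refine ⟨ρ / 2, by positivity, fun y₁ hy₁ => ?_⟩
  have hy₁Ω : y₁ ∈ Ω :=
    hball (Metric.ball_subset_closedBall (Metric.ball_subset_ball (by linarith) hy₁))
  by_contra hne
  have hy₁lt : v y₁ ≠ M := fun h => hne ⟨hy₁Ω, h⟩
  have hT : IsCompact {y | y ∈ Metric.closedBall y₀ ρ ∧ v y = M} :=
    (isCompact_closedBall y₀ ρ).of_isClosed_subset
      ((hcont.mono hball).preimage_isClosed_of_isClosed Metric.isClosed_closedBall
        (isClosed_singleton (x := M))) inter_subset_left
  have hy₀T : y₀ ∈ {y | y ∈ Metric.closedBall y₀ ρ ∧ v y = M} :=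
    ⟨Metric.mem_closedBall_self hρ.le, hy₀M⟩
  obtain ⟨x, ⟨hxρ, hxM⟩, hxmin⟩ := hT.exists_isMinOn ⟨y₀, hy₀T⟩
    (f := fun y => dist y y₁) (by fun_prop)
  set d := dist x y₁ with hd
  have hdpos : 0 < d := dist_pos.2 fun h => hy₁lt (h ▸ hxM)
  have hdy : d ≤ dist y₀ y₁ := hxmin hy₀T
  have hy₁d : dist y₁ y₀ < ρ / 2 := hy₁
  rw [dist_comm] at hdy
  have hsub : Metric.closedBall y₁ d ⊆ Metric.ball y₀ ρ := fun y hy => by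
    have := dist_triangle y y₁ y₀
    have := Metric.mem_closedBall.1 hy
    rw [Metric.mem_ball]
    linarith
  have hsubΩ : Metric.closedBall y₁ d ⊆ Ω :=
    hsub.trans (Metric.ball_subset_closedBall.trans hball)
  have hxΩ : x ∈ Ω := hball hxρ
  set n := d⁻¹ • (x - y₁) with hn
  have hcen : x - d • n = y₁ := by rw [hn, smul_inv_smul₀ hdpos.ne']; abel
  have hnorm : ‖n‖ = 1 := by
    rw [hn, norm_smul, ← dist_eq_norm, ← hd, norm_inv, Real.norm_of_nonneg hdpos.le,
      inv_mul_cancel₀ hdpos.ne']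
  refine not_hasDerivWithinAt_zero_of_lt_on_ball (v := v) (x := x) (n := n) (r := d) (M := M)
    hdpos hnorm ?_ ?_ ?_ ?_ hxM ?_
  · rw [hcen]
    exact hv.mono (Metric.ball_subset_closedBall.trans hsubΩ)
  · rw [hcen]
    exact hcont.mono hsubΩ
  · rw [hcen]
    intro y hy
    refine lt_of_le_of_ne (hle y (hsubΩ (Metric.ball_subset_closedBall hy))) fun h => ?_
    have h1 : d ≤ dist y y₁ := hxmin (show y ∈ {y | y ∈ Metric.closedBall y₀ ρ ∧ v y = M} from
      ⟨Metric.ball_subset_closedBall (hsub (Metric.ball_subset_closedBall hy)), h⟩)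
    exact absurd (Metric.mem_ball.1 hy) (not_lt.2 h1)
  · rw [hcen]
    exact fun y hy => hle y (hsubΩ hy)
  · have hmax : IsLocalMax v x := by
      filter_upwards [hΩ.mem_nhds hxΩ] with y hy
      rw [hxM]
      exact hle y hy
    have hg := hv.hasGradientAt hΩ hxΩ
    have hg0 : gradient v x = 0 := by
      rw [gradient, hmax.fderiv_eq_zero, map_zero]
    rw [hg0] at hg
    have := HasGradientAt.hasDerivAt_line (y := x) (e := n) (t := 0) (by simpa using hg)
    simpa using this.hasDerivWithinAt

/-- **Strong maximum principle** for harmonic functions. -/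
theorem eq_on_connectedComponentIn_of_le {N : ℕ} {Ω : Set (EuclideanSpace ℝ (Fin N))}
    (hΩ : IsOpen Ω) {v : EuclideanSpace ℝ (Fin N) → ℝ}
    (hv : SolvesDivergenceEq Ω (fun _ => 1) v) {M : ℝ} (hle : ∀ y ∈ Ω, v y ≤ M)
    {x : EuclideanSpace ℝ (Fin N)} (hx : x ∈ Ω) (hxM : v x = M) :
    ∀ y ∈ connectedComponentIn Ω x, v y = M := by
  have hT : IsOpen (Ω ∩ v ⁻¹' Iio M) :=
    hv.contDiffOn.continuousOn.isOpen_inter_preimage hΩ isOpen_Iio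
  have hsub : connectedComponentIn Ω x ⊆ {y | y ∈ Ω ∧ v y = M} :=
    isPreconnected_connectedComponentIn.subset_left_of_subset_union
      (isOpen_setOf_eq_of_le hΩ hv hle) hT
      (disjoint_left.2 fun y h1 h2 => (ne_of_lt (show v y < M from h2.2)) h1.2)
      (fun y hy => by
        have hyΩ := connectedComponentIn_subset Ω x hy
        rcases eq_or_lt_of_le (hle y hyΩ) with h | h
        · exact Or.inl ⟨hyΩ, h⟩
        · exact Or.inr ⟨hyΩ, h⟩)
      ⟨x, mem_connectedComponentIn hx, hx, hxM⟩
  exact fun y hy => (hsub hy).2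

theorem MixedDomain.boundary_subset_closure {N : ℕ} {Ω Γ₁ Γ₂ Γ₃ : Set (EuclideanSpace ℝ (Fin N))}
    (h : MixedDomain Ω Γ₁ Γ₂ Γ₃) : Γ₁ ∪ Γ₂ ∪ Γ₃ ⊆ closure Ω :=
  h.union_eq ▸ frontier_subset_closure

theorem MixedDomain.isCompact_closure {N : ℕ} {Ω Γ₁ Γ₂ Γ₃ : Set (EuclideanSpace ℝ (Fin N))}
    (h : MixedDomain Ω Γ₁ Γ₂ Γ₃) : IsCompact (closure Ω) := h.isBounded.isCompact_closure

theorem IsOutwardUnitNormal.norm_eq_one {N : ℕ} {Ω : Set (EuclideanSpace ℝ (Fin N))}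
    {x n : EuclideanSpace ℝ (Fin N)} (h : IsOutwardUnitNormal Ω x n) : ‖n‖ = 1 := by
  obtain ⟨ρ, -, -, hne, -, rfl⟩ := h
  rw [norm_smul, norm_inv, norm_norm, inv_mul_cancel₀ (norm_ne_zero_iff.2 hne)]

/-- Maximum principle for the mixed Laplace problem: the maximum is taken on the Dirichlet part of
the boundary, as Hopf's lemma excludes the Neumann part. -/
theorem MixedDomain.le_of_mixedBoundaryConditions {N : ℕ}
    {Ω Γ₁ Γ₂ Γ₃ : Set (EuclideanSpace ℝ (Fin N))} (hΩ : MixedDomain Ω Γ₁ Γ₂ Γ₃)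
    {v : EuclideanSpace ℝ (Fin N) → ℝ} (hv : SolvesDivergenceEq Ω (fun _ => 1) v) {c₁ c₂ M : ℝ}
    (hbc : MixedBoundaryConditions Ω Γ₁ Γ₂ Γ₃ c₁ c₂ v) (h₁ : c₁ ≤ M) (h₂ : c₂ ≤ M) :
    ∀ x ∈ closure Ω, v x ≤ M := by
  intro x hx
  obtain ⟨x₀, hx₀, hmax⟩ := hΩ.isCompact_closure.exists_isMaxOn ⟨x, hx⟩ hbc.continuousOn
  refine (hmax hx).trans ?_
  by_contra hlt
  push Not at hlt
  have hmaxΩ : ∀ y ∈ Ω, v y ≤ v x₀ := fun y hy => hmax (subset_closure hy)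
  obtain ⟨y, hy, hyM⟩ : ∃ y ∈ Ω, v y = v x₀ := by
    by_cases hx₀Ω : x₀ ∈ Ω
    · exact ⟨x₀, hx₀Ω, rfl⟩
    have hfr : x₀ ∈ Γ₁ ∪ Γ₂ ∪ Γ₃ := by
      rw [hΩ.union_eq, hΩ.isOpen.frontier_eq]
      exact ⟨hx₀, hx₀Ω⟩
    rcases hfr with (h | h) | h
    · linarith [hbc.dirichlet₁ x₀ h]
    · linarith [hbc.dirichlet₂ x₀ h]
    obtain ⟨n, hn, r, hr, hball⟩ := hΩ.interior_ball x₀ h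
    by_contra hne
    push Not at hne
    have hcl : Metric.closedBall (x₀ - r • n) r ⊆ closure Ω := by
      rw [← closure_ball _ hr.ne']
      exact closure_mono hball
    exact not_hasDerivWithinAt_zero_of_lt_on_ball hr hn.norm_eq_one (hv.mono hball)
      (hbc.continuousOn.mono hcl)
      (fun y hy => lt_of_le_of_ne (hmaxΩ y (hball hy)) (hne y (hball hy)))
      (fun y hy => hmax (hcl hy)) rfl (hbc.neumann x₀ h n hn)
  have hcomp := eq_on_connectedComponentIn_of_le hΩ.isOpen hv hmaxΩ hy hyM
  obtain ⟨b, hbcl, hb⟩ := hΩ.component_meets y hy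
  have hsub : closure (connectedComponentIn Ω y) ⊆ closure Ω :=
    closure_mono (connectedComponentIn_subset Ω y)
  have hvb : v b = v x₀ := by
    have : EqOn v (fun _ => v x₀) (closure (connectedComponentIn Ω y)) :=
      EqOn.of_subset_closure (s := connectedComponentIn Ω y) hcomp
        (hbc.continuousOn.mono hsub) continuousOn_const subset_closure Subset.rfl
    exact this hbcl
  rcases hb with hb | hb
  · linarith [hbc.dirichlet₁ b hb]
  · linarith [hbc.dirichlet₂ b hb]

theorem SolvesDivergenceEq.add_const_mul {N : ℕ} {Ω : Set (EuclideanSpace ℝ (Fin N))}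
    (hΩ : IsOpen Ω) {v z : EuclideanSpace ℝ (Fin N) → ℝ}
    (hv : SolvesDivergenceEq Ω (fun _ => 1) v) (hz : SolvesDivergenceEq Ω (fun _ => 1) z)
    (k : ℝ) : SolvesDivergenceEq Ω (fun _ => 1) (fun x => v x + k * z x) := by
  have hgrad : ∀ x ∈ Ω, gradient (fun x => v x + k * z x) x = gradient v x + k • gradient z x := by
    intro x hx
    refine HasGradientAt.gradient ?_
    have h1 := hasGradientAt_iff_hasFDerivAt.1 (hv.hasGradientAt hΩ hx)
    have h2 := hasGradientAt_iff_hasFDerivAt.1 (hz.hasGradientAt hΩ hx)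
    rw [hasGradientAt_iff_hasFDerivAt]
    convert! h1.add (h2.const_mul k) using 1
    rw [map_add, map_smul]
  refine ⟨hv.contDiffOn.add (contDiffOn_const.mul hz.contDiffOn), ?_, fun x hx => ?_⟩
  · refine ContDiffOn.congr (f := fun x => gradient v x + k • gradient z x) ?_
      fun x hx => by rw [one_smul, hgrad x hx]
    have h1 := hv.contDiffOn_flux
    have h2 := hz.contDiffOn_flux
    simp only [one_smul] at h1 h2
    exact h1.add (h2.const_smul k)
  · have hdv := hv.differentiableAt_gradient hΩ hx
    have hdz := hz.differentiableAt_gradient hΩ hx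
    have hkz : DifferentiableAt ℝ (fun y => k • gradient z y) x := hdz.const_smul k
    have h1 := hv.divergence_eq x hx
    have h2 := hz.divergence_eq x hx
    simp only [one_smul] at h1 h2 ⊢
    rw [divergence_congr (W := fun x => gradient v x + k • gradient z x),
      divergence_add hdv hkz, divergence_const_smul k hdz]
    · simp only [h1, h2, mul_zero, add_zero]
    · filter_upwards [hΩ.mem_nhds hx] with y hy using hgrad y hy

theorem MixedBoundaryConditions.add_const_mul {N : ℕ}
    {Ω Γ₁ Γ₂ Γ₃ : Set (EuclideanSpace ℝ (Fin N))} {v z : EuclideanSpace ℝ (Fin N) → ℝ}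
    {c₁ c₂ d₁ d₂ : ℝ} (hv : MixedBoundaryConditions Ω Γ₁ Γ₂ Γ₃ c₁ c₂ v)
    (hz : MixedBoundaryConditions Ω Γ₁ Γ₂ Γ₃ d₁ d₂ z) (k : ℝ) :
    MixedBoundaryConditions Ω Γ₁ Γ₂ Γ₃ (c₁ + k * d₁) (c₂ + k * d₂) (fun x => v x + k * z x) where
  continuousOn := hv.continuousOn.add (continuousOn_const.mul hz.continuousOn)
  dirichlet₁ x hx := by rw [hv.dirichlet₁ x hx, hz.dirichlet₁ x hx]
  dirichlet₂ x hx := by rw [hv.dirichlet₂ x hx, hz.dirichlet₂ x hx]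
  neumann x hx n hn := by
    convert! (hv.neumann x hx n hn).add ((hz.neumann x hx n hn).const_mul k) using 1
    simp

/-- A solution of the mixed Laplace problem is determined by its Dirichlet data. -/
theorem MixedDomain.eqOn_of_mixedBoundaryConditions {N : ℕ}
    {Ω Γ₁ Γ₂ Γ₃ : Set (EuclideanSpace ℝ (Fin N))} (hΩ : MixedDomain Ω Γ₁ Γ₂ Γ₃)
    {v z : EuclideanSpace ℝ (Fin N) → ℝ} (hv : SolvesDivergenceEq Ω (fun _ => 1) v)
    (hz : SolvesDivergenceEq Ω (fun _ => 1) z) {c₁ c₂ : ℝ}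
    (hvbc : MixedBoundaryConditions Ω Γ₁ Γ₂ Γ₃ c₁ c₂ v)
    (hzbc : MixedBoundaryConditions Ω Γ₁ Γ₂ Γ₃ c₁ c₂ z) : EqOn v z (closure Ω) := by
  intro x hx
  have h1 := hΩ.le_of_mixedBoundaryConditions (M := 0) (hv.add_const_mul hΩ.isOpen hz (-1))
    (hvbc.add_const_mul hzbc (-1)) (by linarith) (by linarith) x hx
  have h2 := hΩ.le_of_mixedBoundaryConditions (M := 0) (hz.add_const_mul hΩ.isOpen hv (-1))
    (hzbc.add_const_mul hvbc (-1)) (by linarith) (by linarith) x hx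
  linarith

/-! ### Changes of the dependent variable and the range of the solution of the Laplace problem -/

theorem HasGradientAt.comp_hasDerivWithinAt {N : ℕ} {v : EuclideanSpace ℝ (Fin N) → ℝ}
    {g x : EuclideanSpace ℝ (Fin N)} {φ : ℝ → ℝ} {d : ℝ} {K : Set ℝ} (hv : HasGradientAt v g x)
    (hφ : HasDerivWithinAt φ d K (v x)) (hK : ∀ᶠ y in 𝓝 x, v y ∈ K) :
    HasGradientAt (fun y => φ (v y)) (d • g) x := by
  have h1 := hφ.comp_hasFDerivWithinAt (s := v ⁻¹' K) x
    (hasGradientAt_iff_hasFDerivAt.1 hv).hasFDerivWithinAt (mapsTo_preimage v K)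
  rw [hasGradientAt_iff_hasFDerivAt, map_smul]
  exact h1.hasFDerivAt hK

theorem contDiffOn_one_of_hasGradientAt {N : ℕ} {Ω : Set (EuclideanSpace ℝ (Fin N))}
    (hΩ : IsOpen Ω) {f : EuclideanSpace ℝ (Fin N) → ℝ}
    {g : EuclideanSpace ℝ (Fin N) → EuclideanSpace ℝ (Fin N)}
    (hf : ∀ x ∈ Ω, HasGradientAt f (g x) x) (hg : ContinuousOn g Ω) : ContDiffOn ℝ 1 f Ω := by
  have hd : ∀ x ∈ Ω, HasFDerivAt f (InnerProductSpace.toDual ℝ _ (g x)) x := fun x hx =>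
    hasGradientAt_iff_hasFDerivAt.1 (hf x hx)
  have h0 : ContDiffOn ℝ (0 + 1) f Ω := by
    rw [contDiffOn_succ_iff_fderiv_of_isOpen hΩ]
    refine ⟨fun x hx => (hd x hx).differentiableAt.differentiableWithinAt, by simp, ?_⟩
    rw [contDiffOn_zero]
    refine ContinuousOn.congr (f := fun x => InnerProductSpace.toDual ℝ _ (g x)) ?_
      fun x hx => (hd x hx).fderiv
    exact (InnerProductSpace.toDual ℝ _).continuous.comp_continuousOn hg
  simpa using h0

/-- A function whose flux is a constant multiple of a divergence-free flux solves the corresponding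
divergence equation. All changes of the dependent variable are instances of this. -/
theorem SolvesDivergenceEq.of_flux_eq {N : ℕ} {Ω : Set (EuclideanSpace ℝ (Fin N))}
    (hΩ : IsOpen Ω) {κ κ' v f : EuclideanSpace ℝ (Fin N) → ℝ}
    {g : EuclideanSpace ℝ (Fin N) → EuclideanSpace ℝ (Fin N)} {m : ℝ}
    (hv : SolvesDivergenceEq Ω κ v) (hf : ∀ x ∈ Ω, HasGradientAt f (g x) x)
    (hg : ContinuousOn g Ω) (hflux : ∀ x ∈ Ω, κ' x • g x = m • (κ x • gradient v x)) :
    SolvesDivergenceEq Ω κ' f := by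
  have heq : ∀ x ∈ Ω, κ' x • gradient f x = m • (κ x • gradient v x) := fun x hx => by
    rw [(hf x hx).gradient, hflux x hx]
  refine ⟨contDiffOn_one_of_hasGradientAt hΩ hf hg,
    (hv.contDiffOn_flux.const_smul m).congr heq, fun x hx => ?_⟩
  rw [divergence_congr (W := fun x => m • (κ x • gradient v x))
      (by filter_upwards [hΩ.mem_nhds hx] with y hy using heq y hy),
    divergence_const_smul m ((hv.contDiffOn_flux.contDiffAt (hΩ.mem_nhds hx)).differentiableAt
      one_ne_zero), hv.divergence_eq x hx, mul_zero]

theorem SolvesDivergenceEq.continuousOn_gradient {N : ℕ} {Ω : Set (EuclideanSpace ℝ (Fin N))}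
    (hΩ : IsOpen Ω) {κ v : EuclideanSpace ℝ (Fin N) → ℝ} (hv : SolvesDivergenceEq Ω κ v) :
    ContinuousOn (gradient v) Ω :=
  (InnerProductSpace.toDual ℝ _).symm.continuous.comp_continuousOn
    (hv.contDiffOn.continuousOn_fderiv_of_isOpen hΩ le_rfl)

theorem MixedBoundaryConditions.comp {N : ℕ} {Ω Γ₁ Γ₂ Γ₃ : Set (EuclideanSpace ℝ (Fin N))}
    (hΩ : MixedDomain Ω Γ₁ Γ₂ Γ₃) {v : EuclideanSpace ℝ (Fin N) → ℝ} {c₁ c₂ : ℝ}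
    (hv : MixedBoundaryConditions Ω Γ₁ Γ₂ Γ₃ c₁ c₂ v) {φ : ℝ → ℝ}
    (hφ : ∀ x ∈ closure Ω, DifferentiableAt ℝ φ (v x)) :
    MixedBoundaryConditions Ω Γ₁ Γ₂ Γ₃ (φ c₁) (φ c₂) (fun x => φ (v x)) where
  continuousOn x hx :=
    (hφ x hx).continuousAt.comp_continuousWithinAt (hv.continuousOn x hx)
  dirichlet₁ x hx := by rw [hv.dirichlet₁ x hx]
  dirichlet₂ x hx := by rw [hv.dirichlet₂ x hx]
  neumann x hx n hn := by
    have h1 : HasDerivAt φ (deriv φ (v x)) (v (x + (0 : ℝ) • n)) := by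
      simpa using (hφ x (hΩ.boundary_subset_closure (Or.inr hx))).hasDerivAt
    simpa [Function.comp_def] using h1.comp_hasDerivWithinAt (0 : ℝ) (hv.neumann x hx n hn)

section

variable {N : ℕ} {Ω Γ₁ Γ₂ Γ₃ : Set (EuclideanSpace ℝ (Fin N))} {z : EuclideanSpace ℝ (Fin N) → ℝ}

theorem MixedDomain.mem_Icc_of_mixedLaplace (hΩ : MixedDomain Ω Γ₁ Γ₂ Γ₃)
    (hz : SolvesDivergenceEq Ω (fun _ => 1) z)
    (hbc : MixedBoundaryConditions Ω Γ₁ Γ₂ Γ₃ 0 1 z) {x : EuclideanSpace ℝ (Fin N)}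
    (hx : x ∈ closure Ω) : z x ∈ Icc (0 : ℝ) 1 := by
  have h1 := hΩ.le_of_mixedBoundaryConditions hz hbc (M := 1) (by norm_num) le_rfl x hx
  have h2 := hΩ.le_of_mixedBoundaryConditions (M := 0) (hz.add_const_mul hΩ.isOpen hz (-2))
    (hbc.add_const_mul hbc (-2)) (by norm_num) (by norm_num) x hx
  exact ⟨by linarith, h1⟩

theorem MixedDomain.nonempty₁_of_eq_zero (hΩ : MixedDomain Ω Γ₁ Γ₂ Γ₃)
    (hz : SolvesDivergenceEq Ω (fun _ => 1) z)
    (hbc : MixedBoundaryConditions Ω Γ₁ Γ₂ Γ₃ 0 1 z) {x : EuclideanSpace ℝ (Fin N)}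
    (hx : x ∈ closure Ω) (h0 : z x = 0) : Γ₁.Nonempty := by
  by_contra hne
  have hbc' : MixedBoundaryConditions Ω Γ₁ Γ₂ Γ₃ 1 1 z :=
    ⟨hbc.1, fun y hy => (hne ⟨y, hy⟩).elim, hbc.3, hbc.4⟩
  have h2 := hΩ.le_of_mixedBoundaryConditions (M := -1) (hz.add_const_mul hΩ.isOpen hz (-2))
    (hbc'.add_const_mul hbc' (-2)) (by norm_num) (by norm_num) x hx
  linarith

theorem MixedDomain.nonempty₂_of_eq_one (hΩ : MixedDomain Ω Γ₁ Γ₂ Γ₃)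
    (hz : SolvesDivergenceEq Ω (fun _ => 1) z)
    (hbc : MixedBoundaryConditions Ω Γ₁ Γ₂ Γ₃ 0 1 z) {x : EuclideanSpace ℝ (Fin N)}
    (hx : x ∈ closure Ω) (h1 : z x = 1) : Γ₂.Nonempty := by
  by_contra hne
  have hbc' : MixedBoundaryConditions Ω Γ₁ Γ₂ Γ₃ 0 0 z :=
    ⟨hbc.1, hbc.2, fun y hy => (hne ⟨y, hy⟩).elim, hbc.4⟩
  have h2 := hΩ.le_of_mixedBoundaryConditions (M := 0) hz hbc' le_rfl le_rfl x hx
  linarith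

/-- The solution `z` of the mixed Laplace problem either takes all values in `[0, 1]` or only the
values `0` and `1`. If it misses `s ∈ (0, 1)`, then the indicator of `{z > s}` is locally constant
and has the boundary values of `z`, hence equals `z`. -/
theorem MixedDomain.range_mixedLaplace (hΩ : MixedDomain Ω Γ₁ Γ₂ Γ₃)
    (hz : SolvesDivergenceEq Ω (fun _ => 1) z)
    (hbc : MixedBoundaryConditions Ω Γ₁ Γ₂ Γ₃ 0 1 z) :
    Icc (0 : ℝ) 1 ⊆ z '' closure Ω ∨ ∀ x ∈ closure Ω, z x = 0 ∨ z x = 1 := by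
  by_cases h : Ioo (0 : ℝ) 1 ⊆ z '' closure Ω
  · left
    rw [← closure_Ioo zero_ne_one]
    exact closure_minimal h (hΩ.isCompact_closure.image_of_continuousOn hbc.continuousOn).isClosed
  right
  rw [not_subset] at h
  obtain ⟨s, hs, hsz⟩ := h
  have hne : ∀ x ∈ closure Ω, z x ≠ s := fun x hx hxs => hsz ⟨x, hx, hxs⟩
  set φ : ℝ → ℝ := fun t => if t < s then 0 else 1 with hφ
  have hder : ∀ t, t ≠ s → HasDerivAt φ 0 t := by
    intro t ht
    rcases lt_or_gt_of_ne ht with h | h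
    · refine (hasDerivAt_const t (0 : ℝ)).congr_of_eventuallyEq ?_
      filter_upwards [gt_mem_nhds h] with y hy
      simp [hφ, hy]
    · refine (hasDerivAt_const t (1 : ℝ)).congr_of_eventuallyEq ?_
      filter_upwards [lt_mem_nhds h] with y hy
      simp [hφ, hy.le]
  have hsolves : SolvesDivergenceEq Ω (fun _ => 1) (fun x => φ (z x)) := by
    refine hz.of_flux_eq hΩ.isOpen (g := fun _ => 0) (m := 0) (fun x hx => ?_)
      continuousOn_const (fun x hx => by simp)
    simpa using (hz.hasGradientAt hΩ.isOpen hx).comp_hasDerivWithinAt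
      (hder _ (hne x (subset_closure hx))).hasDerivWithinAt (K := univ) (by simp)
  have hbc' := hbc.comp hΩ (φ := φ) fun x hx => (hder _ (hne x hx)).differentiableAt
  have e0 : φ 0 = 0 := if_pos hs.1
  have e1 : φ 1 = 1 := if_neg (not_lt.2 hs.2.le)
  rw [e0, e1] at hbc'
  intro x hx
  have hxz : φ (z x) = z x := hΩ.eqOn_of_mixedBoundaryConditions hsolves hz hbc' hbc hx
  rw [← hxz]
  simp only [hφ]
  split_ifs <;> simp

end

/-! ### The boundary value problem for `U` -/

theorem HasDerivWithinAt.Ici_of_Icc {U : ℝ → ℝ} {d a b t : ℝ} (ht : t ∈ Ico a b)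
    (h : HasDerivWithinAt U d (Icc a b) t) : HasDerivWithinAt U d (Ici t) t :=
  h.mono_of_mem_nhdsWithin
    (Filter.mem_of_superset (Icc_mem_nhdsGE ht.2) (Icc_subset_Icc_left ht.1))

theorem mem_uIcc_of_hasDerivWithinAt {U g : ℝ → ℝ} {γ a b : ℝ}
    (hU : ∀ t ∈ Icc a b, HasDerivWithinAt U (γ * g t) (Icc a b) t)
    (hg : ∀ t ∈ Icc a b, 0 ≤ g t) {t : ℝ} (ht : t ∈ Icc a b) : U t ∈ uIcc (U a) (U b) := by
  have hab : a ≤ b := ht.1.trans ht.2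
  have hc : ContinuousOn U (Icc a b) := fun s hs => (hU s hs).continuousWithinAt
  have hd : ∀ s ∈ interior (Icc a b), HasDerivAt U (γ * g s) s := fun s hs =>
    (hU s (interior_subset hs)).hasDerivAt (mem_interior_iff_mem_nhds.1 hs)
  have hdiff : DifferentiableOn ℝ U (interior (Icc a b)) := fun s hs =>
    (hd s hs).differentiableAt.differentiableWithinAt
  rcases le_total 0 γ with h | h
  · have hm : MonotoneOn U (Icc a b) := monotoneOn_of_deriv_nonneg (convex_Icc a b) hc hdiff
      fun s hs => by
        rw [(hd s hs).deriv]
        exact mul_nonneg h (hg s (interior_subset hs))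
    exact mem_uIcc_of_le (hm (left_mem_Icc.2 hab) ht ht.1) (hm ht (right_mem_Icc.2 hab) ht.2)
  · have hm : AntitoneOn U (Icc a b) := antitoneOn_of_deriv_nonpos (convex_Icc a b) hc hdiff
      fun s hs => by
        rw [(hd s hs).deriv]
        exact mul_nonpos_of_nonpos_of_nonneg h (hg s (interior_subset hs))
    exact mem_uIcc_of_ge (hm ht (right_mem_Icc.2 hab) ht.2) (hm (left_mem_Icc.2 hab) ht ht.1)

/-- Solvability of a boundary value problem by shooting: the parameter `γ` is adjusted so that the
solution starting from `(a, c)` passes through `(b, d)`. -/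
theorem exists_hasDerivWithinAt_mul_of_bounded {F : ℝ → ℝ → ℝ} {K : NNReal} {m M a b : ℝ}
    (hab : a < b) (hF : ∀ U, Continuous fun t => F t U) (hLip : ∀ t, LipschitzWith K (F t))
    (hm : 0 < m) (hmF : ∀ t U, m ≤ F t U) (hFM : ∀ t U, F t U ≤ M) (c d : ℝ) :
    ∃ (γ : ℝ) (U : ℝ → ℝ), U a = c ∧ U b = d ∧
      ∀ t ∈ Icc a b, HasDerivWithinAt U (γ * F t (U t)) (Icc a b) t := by
  have hM : 0 ≤ M := (hm.le.trans (hmF a 0)).trans (hFM a 0)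
  have habs : ∀ t U, |F t U| ≤ M := fun t U =>
    abs_le.2 ⟨by linarith [hmF t U], hFM t U⟩
  have hlipγ : ∀ γ t : ℝ, LipschitzWith (‖γ‖₊ * K) (fun U => γ * F t U) := fun γ t =>
    LipschitzWith.of_dist_le_mul fun U V => by
      rw [Real.dist_eq, ← mul_sub, abs_mul, NNReal.coe_mul, coe_nnnorm, Real.norm_eq_abs, mul_assoc]
      exact mul_le_mul_of_nonneg_left ((hLip t).dist_le_mul U V) (abs_nonneg γ)
  have hsol : ∀ γ : ℝ, ∃ U : ℝ → ℝ, U a = c ∧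
      ∀ t ∈ Icc a b, HasDerivWithinAt U (γ * F t (U t)) (Icc a b) t := by
    intro γ
    have hPL : IsPicardLindelof (fun t U => γ * F t U) (tmin := a) (tmax := b)
        ⟨a, left_mem_Icc.2 hab.le⟩ c (‖γ‖₊ * M.toNNReal * (b - a).toNNReal) 0 (‖γ‖₊ * M.toNNReal)
        (‖γ‖₊ * K) := by
      refine ⟨fun t _ => (hlipγ γ t).lipschitzOnWith, fun U _ =>
        (continuous_const.mul (hF U)).continuousOn, fun t _ U _ => ?_, ?_⟩
      · rw [norm_mul, NNReal.coe_mul, Real.coe_toNNReal _ hM, coe_nnnorm]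
        exact mul_le_mul_of_nonneg_left (habs t U) (norm_nonneg γ)
      · simp [Real.coe_toNNReal _ (sub_nonneg.2 hab.le), hab.le]
    exact hPL.exists_eq_forall_mem_Icc_hasDerivWithinAt₀
  choose S hSa hS using hsol
  have hSc : ∀ γ, ContinuousOn (S γ) (Icc a b) := fun γ t ht => (hS γ t ht).continuousWithinAt
  have hcont : Continuous fun γ => S γ b := by
    refine continuous_iff_continuousAt.2 fun γ => ?_
    refine tendsto_iff_dist_tendsto_zero.2 ?_
    have hbound : ∀ δ, dist (S δ b) (S γ b) ≤
        gronwallBound 0 (‖γ‖₊ * K : NNReal) (|δ - γ| * M + 0) (b - a) := by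
      intro δ
      refine dist_le_of_approx_trajectories_ODE (v := fun t U => γ * F t U) (hlipγ γ) (hSc δ)
        (fun t ht => (hS δ t (Ico_subset_Icc_self ht)).Ici_of_Icc ht) (fun t _ => ?_) (hSc γ)
        (fun t ht => (hS γ t (Ico_subset_Icc_self ht)).Ici_of_Icc ht) (fun t _ => ?_)
        (by rw [hSa, hSa, dist_self]) b (right_mem_Icc.2 hab.le)
      · rw [Real.dist_eq, ← sub_mul, abs_mul]
        exact mul_le_mul_of_nonneg_left (habs _ _) (abs_nonneg _)
      · rw [dist_self]
    refine squeeze_zero (fun _ => dist_nonneg) hbound ?_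
    have h1 : Continuous fun δ : ℝ =>
        gronwallBound 0 (‖γ‖₊ * K : NNReal) (|δ - γ| * M + 0) (b - a) :=
      (gronwallBound_continuous_ε _ _ _).comp (by fun_prop)
    simpa [gronwallBound_ε0_δ0] using h1.tendsto γ
  have hint : ∀ γ, ∀ t ∈ interior (Icc a b), HasDerivAt (S γ) (γ * F t (S γ t)) t := fun γ t ht =>
    (hS γ t (interior_subset ht)).hasDerivAt (mem_interior_iff_mem_nhds.1 ht)
  have hdiff : ∀ γ, DifferentiableOn ℝ (S γ) (interior (Icc a b)) := fun γ t ht =>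
    (hint γ t ht).differentiableAt.differentiableWithinAt
  set G := |d - c| / (m * (b - a)) with hG
  have hba : 0 < b - a := sub_pos.2 hab
  have hG0 : 0 ≤ G := by positivity
  have hGm : G * m * (b - a) = |d - c| := by rw [hG]; field_simp
  have hup : d ≤ S G b := by
    have := (convex_Icc a b).mul_sub_le_image_sub_of_le_deriv (hSc G) (hdiff G) (C := G * m)
      (fun t ht => by
        rw [(hint G t ht).deriv]
        exact mul_le_mul_of_nonneg_left (hmF _ _) hG0)
      a (left_mem_Icc.2 hab.le) b (right_mem_Icc.2 hab.le) hab.le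
    rw [hGm, hSa] at this
    linarith [le_abs_self (d - c)]
  have hdown : S (-G) b ≤ d := by
    have := (convex_Icc a b).image_sub_le_mul_sub_of_deriv_le (hSc (-G)) (hdiff (-G))
      (C := -(G * m)) (fun t ht => by
        rw [(hint (-G) t ht).deriv, neg_mul]
        exact neg_le_neg (mul_le_mul_of_nonneg_left (hmF _ _) hG0))
      a (left_mem_Icc.2 hab.le) b (right_mem_Icc.2 hab.le) hab.le
    rw [neg_mul, hGm, hSa] at this
    linarith [neg_abs_le (d - c)]
  obtain ⟨γ, hγ⟩ := mem_range_of_exists_le_of_exists_ge hcont ⟨-G, hdown⟩ ⟨G, hup⟩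
  exact ⟨γ, S γ, hSa γ, hγ, hS γ⟩

/-- The boundary value problem on a rectangle. The right-hand side is extended constantly beyond the
rectangle, where the solution does not go because it is monotone. -/
theorem exists_hasDerivWithinAt_mul_of_contDiffOn {f : ℝ × ℝ → ℝ} {u₁ u₂ w₁ w₂ : ℝ} (hw : w₁ < w₂)
    (hf : ContDiffOn ℝ 1 f (uIcc u₁ u₂ ×ˢ Icc w₁ w₂))
    (hpos : ∀ y ∈ uIcc u₁ u₂ ×ˢ Icc w₁ w₂, 0 < f y) :
    ∃ (γ : ℝ) (U : ℝ → ℝ), U w₁ = u₁ ∧ U w₂ = u₂ ∧ (∀ t ∈ Icc w₁ w₂, U t ∈ uIcc u₁ u₂) ∧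
      ∀ t ∈ Icc w₁ w₂, HasDerivWithinAt U (γ * f (U t, t)) (Icc w₁ w₂) t := by
  have hcomp : IsCompact (uIcc u₁ u₂ ×ˢ Icc w₁ w₂) := isCompact_uIcc.prod isCompact_Icc
  have hne : (uIcc u₁ u₂ ×ˢ Icc w₁ w₂).Nonempty :=
    ⟨(u₁, w₁), left_mem_uIcc, left_mem_Icc.2 hw.le⟩
  obtain ⟨K, hK⟩ := hf.exists_lipschitzOnWith one_ne_zero
    ((convex_uIcc u₁ u₂).prod (convex_Icc w₁ w₂)) hcomp
  obtain ⟨ymin, hymin, hmin⟩ := hcomp.exists_isMinOn hne hf.continuousOn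
  obtain ⟨ymax, hymax, hmax⟩ := hcomp.exists_isMaxOn hne hf.continuousOn
  have hu : u₁ ⊓ u₂ ≤ u₁ ⊔ u₂ := inf_le_sup
  set P : ℝ → ℝ → ℝ × ℝ := fun t U => (projIcc (u₁ ⊓ u₂) (u₁ ⊔ u₂) hu U, projIcc w₁ w₂ hw.le t)
  have hP : ∀ t U, P t U ∈ uIcc u₁ u₂ ×ˢ Icc w₁ w₂ := fun t U =>
    ⟨(projIcc (u₁ ⊓ u₂) (u₁ ⊔ u₂) hu U).2, (projIcc w₁ w₂ hw.le t).2⟩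
  obtain ⟨γ, U, hU1, hU2, hU⟩ := exists_hasDerivWithinAt_mul_of_bounded
    (F := fun t U => f (P t U)) (K := K) (m := f ymin) (M := f ymax) hw
    (fun U => hf.continuousOn.comp_continuous (by fun_prop) fun t => hP t U)
    (fun t => LipschitzWith.of_dist_le_mul fun U V => by
      refine (hK.dist_le_mul _ (hP t U) _ (hP t V)).trans
        (mul_le_mul_of_nonneg_left ?_ K.coe_nonneg)
      rw [Prod.dist_eq]
      refine max_le ?_ (by simp [P])
      have := (LipschitzWith.projIcc hu).dist_le_mul U V
      rwa [NNReal.coe_one, one_mul] at this)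
    (hpos _ hymin) (fun t U => hmin (hP t U)) (fun t U => hmax (hP t U)) u₁ u₂
  have hmem : ∀ t ∈ Icc w₁ w₂, U t ∈ uIcc u₁ u₂ := fun t ht => by
    have := mem_uIcc_of_hasDerivWithinAt hU (fun s _ => (hpos _ (hP s (U s))).le) ht
    rwa [hU1, hU2] at this
  refine ⟨γ, U, hU1, hU2, hmem, fun t ht => ?_⟩
  have hPt : P t (U t) = (U t, t) := by
    have h1 : projIcc (u₁ ⊓ u₂) (u₁ ⊔ u₂) hu (U t) = ⟨U t, hmem t ht⟩ := projIcc_of_mem hu (hmem t ht)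
    simp only [P, h1, projIcc_of_mem hw.le ht]
  rw [← hPt]
  exact hU t ht

/-- Solutions of `U' = γ f(U, t)` and `V' = δ f(V, t)` with `f` positive that have the same initial
value do not meet again if `δ < γ`, since `U - V` increases at each of its zeros. -/
theorem ne_of_hasDerivWithinAt_mul_of_lt {f : ℝ → ℝ → ℝ} {U V : ℝ → ℝ} {γ δ a b : ℝ} (hab : a < b)
    (hU : ∀ t ∈ Icc a b, HasDerivWithinAt U (γ * f (U t) t) (Icc a b) t)
    (hV : ∀ t ∈ Icc a b, HasDerivWithinAt V (δ * f (V t) t) (Icc a b) t)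
    (hpos : ∀ t ∈ Icc a b, 0 < f (U t) t) (hlt : δ < γ) (ha : U a = V a) : U b ≠ V b := by
  intro hb
  have hle : ∀ t ∈ Icc a b, V t ≤ U t := fun t ht =>
    image_le_of_deriv_right_lt_deriv_boundary' (fun t ht => (hV t ht).continuousWithinAt)
      (fun t ht => (hV t (Ico_subset_Icc_self ht)).Ici_of_Icc ht) ha.ge
      (fun t ht => (hU t ht).continuousWithinAt)
      (fun t ht => (hU t (Ico_subset_Icc_self ht)).Ici_of_Icc ht)
      (fun t ht h => by
        rw [h]
        exact mul_lt_mul_of_pos_right hlt (hpos t (Ico_subset_Icc_self ht))) ht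
  have hbmem : b ∈ Icc a b := right_mem_Icc.2 hab.le
  have hmin : IsLocalMinOn (U - V) (Icc a b) b := by
    filter_upwards [self_mem_nhdsWithin] with t ht
    have := hle t ht
    simp only [Pi.sub_apply]
    linarith
  have h0 := hmin.hasFDerivWithinAt_nonneg ((hU b hbmem).sub (hV b hbmem)).hasFDerivWithinAt
    (y := a - b) (mem_posTangentConeAt_of_segment_subset (by
      rw [add_sub_cancel, segment_symm, segment_eq_Icc hab.le]))
  have h1 : 0 < (γ - δ) * f (U b) b := mul_pos (sub_pos.2 hlt) (hpos b hbmem)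
  rw [← hb] at h0
  simp at h0
  nlinarith

theorem eqOn_of_hasDerivWithinAt_mul {f : ℝ → ℝ → ℝ} {I : Set ℝ} {U V : ℝ → ℝ} {γ δ a b L : ℝ}
    (hab : a < b) (hLip : ∀ t ∈ Icc a b, ∀ U ∈ I, ∀ V ∈ I, |f U t - f V t| ≤ L * |U - V|)
    (hpos : ∀ t ∈ Icc a b, ∀ U ∈ I, 0 < f U t)
    (hU : ∀ t ∈ Icc a b, HasDerivWithinAt U (γ * f (U t) t) (Icc a b) t)
    (hV : ∀ t ∈ Icc a b, HasDerivWithinAt V (δ * f (V t) t) (Icc a b) t)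
    (hUI : ∀ t ∈ Icc a b, U t ∈ I) (hVI : ∀ t ∈ Icc a b, V t ∈ I)
    (ha : U a = V a) (hb : U b = V b) : EqOn U V (Icc a b) := by
  rcases lt_trichotomy γ δ with h | rfl | h
  · exact absurd hb.symm (ne_of_hasDerivWithinAt_mul_of_lt hab hV hU
      (fun t ht => hpos t ht _ (hVI t ht)) h ha.symm)
  · refine ODE_solution_unique_of_mem_Icc_right (v := fun t U => γ * f U t) (s := fun _ => I)
      (K := ‖γ‖₊ * L.toNNReal)
      (fun t ht => LipschitzOnWith.of_dist_le_mul fun x hx y hy => ?_)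
      (fun t ht => (hU t ht).continuousWithinAt)
      (fun t ht => (hU t (Ico_subset_Icc_self ht)).Ici_of_Icc ht)
      (fun t ht => hUI t (Ico_subset_Icc_self ht)) (fun t ht => (hV t ht).continuousWithinAt)
      (fun t ht => (hV t (Ico_subset_Icc_self ht)).Ici_of_Icc ht)
      (fun t ht => hVI t (Ico_subset_Icc_self ht)) ha
    rw [Real.dist_eq, ← mul_sub, abs_mul, NNReal.coe_mul, coe_nnnorm, Real.norm_eq_abs, mul_assoc]
    refine mul_le_mul_of_nonneg_left ?_ (abs_nonneg γ)
    refine (hLip t (Ico_subset_Icc_self ht) x hx y hy).trans ?_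
    exact mul_le_mul_of_nonneg_right (Real.le_coe_toNNReal L) (abs_nonneg _)
  · exact absurd hb (ne_of_hasDerivWithinAt_mul_of_lt hab hU hV
      (fun t ht => hpos t ht _ (hUI t ht)) h ha)

/-! ### Existence of a functional solution -/

theorem Continuous.hasDerivAt_integral {β : ℝ → ℝ} (hβ : Continuous β) (c t : ℝ) :
    HasDerivAt (fun t => ∫ s in c..t, β s) (β t) t :=
  intervalIntegral.integral_hasDerivAt_right (hβ.intervalIntegrable _ _)
    (hβ.stronglyMeasurableAtFilter _ _) hβ.continuousAt

theorem Continuous.strictMono_integral {β : ℝ → ℝ} (hβ : Continuous β) (hpos : ∀ t, 0 < β t)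
    (c : ℝ) : StrictMono fun t => ∫ s in c..t, β s :=
  strictMono_of_deriv_pos fun t => by
    rw [(hβ.hasDerivAt_integral c t).deriv]
    exact hpos t

/-- A primitive of a continuous function that is bounded below by a positive constant has a
differentiable inverse. -/
theorem exists_leftInverse_integral {β : ℝ → ℝ} (hβ : Continuous β) {k : ℝ} (hk : 0 < k)
    (hle : ∀ t, k ≤ β t) (c : ℝ) :
    ∃ g : ℝ → ℝ, StrictMono g ∧ (∀ t, g (∫ s in c..t, β s) = t) ∧
      ∀ y, HasDerivAt g (β (g y))⁻¹ y := by
  set B : ℝ → ℝ := fun t => ∫ s in c..t, β s with hB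
  have hder : ∀ t, HasDerivAt B (β t) t := hβ.hasDerivAt_integral c
  have hmono : StrictMono B := hβ.strictMono_integral (fun t => hk.trans_le (hle t)) c
  have hBc : B c = 0 := intervalIntegral.integral_same
  have hdiff : Differentiable ℝ B := fun t => (hder t).differentiableAt
  have hgrow : ∀ s t, s ≤ t → k * (t - s) ≤ B t - B s := fun s t hst =>
    mul_sub_le_image_sub_of_le_deriv hdiff (fun t => by rw [(hder t).deriv]; exact hle t) hst
  have hsurj : Function.Surjective B := by
    intro y
    have hy : k * (|y| / k) = |y| := by field_simp
    have hy0 : 0 ≤ |y| / k := by positivity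
    refine mem_range_of_exists_le_of_exists_ge hdiff.continuous ⟨c - |y| / k, ?_⟩ ⟨c + |y| / k, ?_⟩
    · have := hgrow (c - |y| / k) c (by linarith)
      rw [sub_sub_cancel, hy, hBc] at this
      linarith [neg_abs_le y]
    · have := hgrow c (c + |y| / k) (by linarith)
      rw [add_sub_cancel_left, hy, hBc] at this
      linarith [le_abs_self y]
  let e := hmono.orderIsoOfSurjective B hsurj
  refine ⟨e.symm, e.symm.strictMono, fun t => e.symm_apply_apply t, fun y => ?_⟩
  exact HasDerivAt.of_local_left_inverse e.symm.continuous.continuousAt (hder _)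
    (hk.trans_le (hle _)).ne' (Filter.Eventually.of_forall fun y => e.apply_symm_apply y)

/-- A function that is `C¹` on a compact interval extends to a `C¹` function on the line. -/
theorem exists_hasDerivAt_eqOn_Icc {U d : ℝ → ℝ} {a b : ℝ} (hab : a ≤ b)
    (hU : ∀ t ∈ Icc a b, HasDerivWithinAt U (d t) (Icc a b) t) (hd : ContinuousOn d (Icc a b)) :
    ∃ V : ℝ → ℝ, (∀ t, HasDerivAt V (d (projIcc a b hab t)) t) ∧ EqOn U V (Icc a b) := by
  have hdc : Continuous fun t => d (projIcc a b hab t) :=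
    hd.comp_continuous (by fun_prop) fun t => (projIcc a b hab t).2
  have hV : ∀ t, HasDerivAt (fun t => U a + ∫ s in a..t, d (projIcc a b hab s))
      (d (projIcc a b hab t)) t := fun t => (hdc.hasDerivAt_integral a t).const_add (U a)
  refine ⟨_, hV, fun t ht => eq_of_has_deriv_right_eq
    (fun t ht => (hU t (Ico_subset_Icc_self ht)).Ici_of_Icc ht)
    (fun t ht => ?_) (fun t ht => (hU t ht).continuousWithinAt)
    (fun t _ => (hV t).continuousAt.continuousWithinAt) (by simp) t ht⟩
  have := (hV t).hasDerivWithinAt (s := Ici t)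
  rwa [projIcc_of_mem hab (Ico_subset_Icc_self ht)] at this

/-- Existence: `U` solves the boundary value problem `U' = γ b/a`, and `w` is obtained from the
solution `z` of the mixed Laplace problem by inverting the primitive of `t ↦ b(U(t), t)`. -/
theorem exists_isFunctionalSolution {N : ℕ} {Ω Γ₁ Γ₂ Γ₃ : Set (EuclideanSpace ℝ (Fin N))}
    (hΩ : MixedDomain Ω Γ₁ Γ₂ Γ₃) {z : EuclideanSpace ℝ (Fin N) → ℝ}
    (hz : SolvesDivergenceEq Ω (fun _ => 1) z) (hbc : MixedBoundaryConditions Ω Γ₁ Γ₂ Γ₃ 0 1 z)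
    {u₁ u₂ w₁ w₂ : ℝ} (hw : w₁ < w₂) {D : Set (ℝ × ℝ)} (hD : uIcc u₁ u₂ ×ˢ Icc w₁ w₂ ⊆ D)
    {a b : ℝ → ℝ → ℝ} (hb_cont : ContinuousOn (fun y : ℝ × ℝ => b y.1 y.2) D)
    (ha_pos : ∀ y ∈ D, 0 < a y.1 y.2) (hb_pos : ∀ y ∈ D, 0 < b y.1 y.2)
    (hab : ContDiffOn ℝ 1 (fun y : ℝ × ℝ => b y.1 y.2 / a y.1 y.2) (uIcc u₁ u₂ ×ˢ Icc w₁ w₂)) :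
    ∃ u w : EuclideanSpace ℝ (Fin N) → ℝ,
      IsFunctionalSolution Ω Γ₁ Γ₂ Γ₃ D a b u₁ u₂ w₁ w₂ u w := by
  obtain ⟨γ, U, hU1, hU2, hUI, hU⟩ := exists_hasDerivWithinAt_mul_of_contDiffOn hw hab
    fun y hy => div_pos (hb_pos y (hD hy)) (ha_pos y (hD hy))
  have hR : ∀ t ∈ Icc w₁ w₂, (U t, t) ∈ uIcc u₁ u₂ ×ˢ Icc w₁ w₂ := fun t ht => ⟨hUI t ht, ht⟩
  have hUc : ContinuousOn (fun t => (U t, t)) (Icc w₁ w₂) :=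
    ContinuousOn.prodMk (fun t ht => (hU t ht).continuousWithinAt) continuousOn_id
  have hpr : ∀ t, (projIcc w₁ w₂ hw.le t : ℝ) ∈ Icc w₁ w₂ := fun t => (projIcc w₁ w₂ hw.le t).2
  have hρc : ContinuousOn (fun t => γ * (b (U t) t / a (U t) t)) (Icc w₁ w₂) :=
    continuousOn_const.mul (hab.continuousOn.comp hUc hR)
  obtain ⟨V, hV, hUV⟩ := exists_hasDerivAt_eqOn_Icc hw.le hU hρc
  have hVc : Continuous fun t => γ * (b (U (projIcc w₁ w₂ hw.le t)) (projIcc w₁ w₂ hw.le t) /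
      a (U (projIcc w₁ w₂ hw.le t)) (projIcc w₁ w₂ hw.le t)) :=
    hρc.comp_continuous (by fun_prop) hpr
  have hVC1 : ContDiff ℝ 1 V := by
    rw [contDiff_one_iff_deriv]
    refine ⟨fun t => (hV t).differentiableAt, ?_⟩
    rwa [funext fun t => (hV t).deriv]
  set β : ℝ → ℝ := fun t => b (U (projIcc w₁ w₂ hw.le t)) (projIcc w₁ w₂ hw.le t) with hβ
  have hβIcc : ContinuousOn (fun t => b (U t) t) (Icc w₁ w₂) :=
    hb_cont.comp hUc fun t ht => hD (hR t ht)
  have hβc : Continuous β := hβIcc.comp_continuous (by fun_prop) hpr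
  obtain ⟨t₀, ht₀, hmin⟩ := isCompact_Icc.exists_isMinOn ⟨w₁, left_mem_Icc.2 hw.le⟩ hβIcc
  have hk : 0 < b (U t₀) t₀ := hb_pos _ (hD (hR t₀ ht₀))
  have hle : ∀ t, b (U t₀) t₀ ≤ β t := fun t => hmin (hpr t)
  have hβpos : ∀ t, 0 < β t := fun t => hk.trans_le (hle t)
  obtain ⟨g, hgmono, hgB, hg⟩ := exists_leftInverse_integral hβc hk hle w₁
  set m := ∫ s in w₁..w₂, β s with hm
  have hm0 : 0 < m := by
    have := hβc.strictMono_integral hβpos w₁ hw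
    simpa using this
  have hg0 : g 0 = w₁ := by simpa using hgB w₁
  have hgm : g m = w₂ := hgB w₂
  set φ : ℝ → ℝ := fun y => g (m * y) with hφ
  have hφd : ∀ y, HasDerivAt φ ((β (φ y))⁻¹ * m) y := fun y =>
    (hg (m * y)).comp y (by simpa using (hasDerivAt_id y).const_mul m)
  set w : EuclideanSpace ℝ (Fin N) → ℝ := fun x => φ (z x) with hwdef
  have hwIcc : ∀ x ∈ closure Ω, w x ∈ Icc w₁ w₂ := by
    intro x hx
    have h01 := hΩ.mem_Icc_of_mixedLaplace hz hbc hx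
    rw [← hg0, ← hgm]
    exact ⟨hgmono.monotone (mul_nonneg hm0.le h01.1),
      hgmono.monotone (mul_le_of_le_one_right hm0.le h01.2)⟩
  have hprw : ∀ x ∈ closure Ω, (projIcc w₁ w₂ hw.le (w x) : ℝ) = w x := fun x hx => by
    rw [projIcc_of_mem hw.le (hwIcc x hx)]
  have hVw : ∀ x ∈ closure Ω, V (w x) = U (w x) := fun x hx => (hUV (hwIcc x hx)).symm
  have hmemD : ∀ x ∈ closure Ω, (V (w x), w x) ∈ D := fun x hx => by
    rw [hVw x hx]
    exact hD (hR _ (hwIcc x hx))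
  have hbcw := hbc.comp hΩ (φ := φ) fun x _ => (hφd _).differentiableAt
  have e0 : φ 0 = w₁ := by simp [hφ, hg0]
  have e1 : φ 1 = w₂ := by simp [hφ, hgm]
  rw [e0, e1] at hbcw
  have hbcu := hbcw.comp hΩ (φ := V) fun x _ => (hV _).differentiableAt
  rw [← hUV (left_mem_Icc.2 hw.le), ← hUV (right_mem_Icc.2 hw.le), hU1, hU2] at hbcu
  have hwcont : ContinuousOn w Ω := hbcw.continuousOn.mono subset_closure
  have hgradw : ∀ x ∈ Ω, HasGradientAt w (((β (w x))⁻¹ * m) • gradient z x) x := fun x hx =>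
    (hz.hasGradientAt hΩ.isOpen hx).comp_hasDerivWithinAt (hφd (z x)).hasDerivWithinAt
      (K := univ) (by simp)
  have hgradw_cont : ContinuousOn (fun x => ((β (w x))⁻¹ * m) • gradient z x) Ω :=
    (((hβc.comp_continuousOn hwcont).inv₀ fun x _ => (hβpos _).ne').mul continuousOn_const).smul
      (hz.continuousOn_gradient hΩ.isOpen)
  have hβw : ∀ x ∈ closure Ω, β (w x) = b (V (w x)) (w x) := fun x hx => by
    simp only [hβ, hprw x hx, hVw x hx]
  refine ⟨fun x => V (w x), w, ⟨hmemD, ?_, hbcu, ?_, hbcw⟩, V, hVC1.contDiffOn,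
    fun x hx => ⟨hwIcc x hx, rfl⟩⟩
  · refine hz.of_flux_eq hΩ.isOpen (m := γ * m) (fun x hx => (hgradw x hx).comp_hasDerivWithinAt
      (hV (w x)).hasDerivWithinAt (K := univ) (by simp))
      ((hVc.comp_continuousOn hwcont).smul hgradw_cont) fun x hx => ?_
    have hx' := subset_closure hx
    have ha := (ha_pos _ (hmemD x hx')).ne'
    have hb := (hb_pos _ (hmemD x hx')).ne'
    rw [hβw x hx', hprw x hx', ← hVw x hx', one_smul, smul_smul, smul_smul]
    congr 1
    simp only at ha hb
    field_simp
  · refine hz.of_flux_eq hΩ.isOpen (m := m) hgradw hgradw_cont fun x hx => ?_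
    have hb := (hβpos (w x)).ne'
    rw [← hβw x (subset_closure hx), one_smul, smul_smul]
    congr 1
    field_simp

/-! ### Uniqueness of the functional solution -/

/-- A positive continuous function on a closed set extends to a positive continuous function. -/
theorem exists_continuous_pos_eqOn {K : Set ℝ} (hK : IsClosed K) {β : ℝ → ℝ}
    (hβ : ContinuousOn β K) (hpos : ∀ t ∈ K, 0 < β t) :
    ∃ β' : ℝ → ℝ, Continuous β' ∧ (∀ t, 0 < β' t) ∧ EqOn β' β K := by
  obtain ⟨g, hg, hgK⟩ := ContinuousMap.exists_restrict_eq_forall_mem_of_closed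
    (⟨K.domRestrict β, hβ.domRestrict⟩ : C(K, ℝ)) (t := Ioi 0) (fun x => hpos x x.2) ⟨1, mem_Ioi.2 one_pos⟩ hK
  exact ⟨g, g.continuous, hg, fun t ht => congrArg (fun h : C(K, ℝ) => h ⟨t, ht⟩) hgK⟩

section

variable {N : ℕ} {Ω Γ₁ Γ₂ Γ₃ : Set (EuclideanSpace ℝ (Fin N))} {z : EuclideanSpace ℝ (Fin N) → ℝ}
  {u₁ u₂ w₁ w₂ : ℝ} {D : Set (ℝ × ℝ)} {a b : ℝ → ℝ → ℝ} {u w : EuclideanSpace ℝ (Fin N) → ℝ}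
  {U : ℝ → ℝ}

/-- If `β(w) ∇w` is a divergence-free flux, then the primitive of `β`, evaluated at `w`, is harmonic
and determined by its Dirichlet data, hence a multiple of `z`. -/
theorem MixedDomain.integral_eq_mul_of_flux (hΩ : MixedDomain Ω Γ₁ Γ₂ Γ₃)
    (hz : SolvesDivergenceEq Ω (fun _ => 1) z) (hbc : MixedBoundaryConditions Ω Γ₁ Γ₂ Γ₃ 0 1 z)
    {κ v κw : EuclideanSpace ℝ (Fin N) → ℝ} (hv : SolvesDivergenceEq Ω κ v)
    (hw : SolvesDivergenceEq Ω κw w) (hwbc : MixedBoundaryConditions Ω Γ₁ Γ₂ Γ₃ w₁ w₂ w)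
    {β : ℝ → ℝ} (hβ : Continuous β)
    (hflux : ∀ x ∈ Ω, β (w x) • gradient w x = κ x • gradient v x) {x : EuclideanSpace ℝ (Fin N)}
    (hx : x ∈ closure Ω) : ∫ s in w₁..w x, β s = (∫ s in w₁..w₂, β s) * z x := by
  have hder := hβ.hasDerivAt_integral w₁
  have hsol : SolvesDivergenceEq Ω (fun _ => 1) (fun x => ∫ s in w₁..w x, β s) := by
    refine hv.of_flux_eq hΩ.isOpen (m := 1) (fun x hx =>
      (hw.hasGradientAt hΩ.isOpen hx).comp_hasDerivWithinAt (hder (w x)).hasDerivWithinAt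
        (K := univ) (by simp))
      ((hβ.comp_continuousOn (hwbc.continuousOn.mono subset_closure)).smul
        (hw.continuousOn_gradient hΩ.isOpen)) fun x hx => ?_
    rw [one_smul, one_smul, hflux x hx]
  have hsol' := hsol.add_const_mul hΩ.isOpen hz (-∫ s in w₁..w₂, β s)
  have hbc' := (hwbc.comp hΩ (φ := fun t => ∫ s in w₁..t, β s)
    fun x _ => (hder _).differentiableAt).add_const_mul hbc (-∫ s in w₁..w₂, β s)
  -- the zero function, as `z - z`
  have hzero : SolvesDivergenceEq Ω (fun _ => 1) (fun x => z x + (-1) * z x) :=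
    hz.add_const_mul hΩ.isOpen hz (-1)
  have hbczero := hbc.add_const_mul hbc (-1)
  have e1 : (∫ s in w₁..w₁, β s) + -(∫ s in w₁..w₂, β s) * 0 = 0 + -1 * 0 := by simp
  have e2 : (∫ s in w₁..w₂, β s) + -(∫ s in w₁..w₂, β s) * 1 = 1 + -1 * 1 := by ring
  rw [e1, e2] at hbc'
  have := hΩ.eqOn_of_mixedBoundaryConditions hsol' hzero hbc' hbczero hx
  simp only at this
  linarith

/-- For a functional solution, the primitives of `b(U(t), t)` and `a(U(t), t) U'(t)` turn `w` into
harmonic functions, that is, into multiples of `z`. The coefficients are known only on the range of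
`w`, and are extended to the line. -/
theorem IsClassicalSolution.exists_integral_eq_mul (hΩ : MixedDomain Ω Γ₁ Γ₂ Γ₃)
    (hz : SolvesDivergenceEq Ω (fun _ => 1) z) (hbc : MixedBoundaryConditions Ω Γ₁ Γ₂ Γ₃ 0 1 z)
    (hw : w₁ < w₂) (ha_cont : ContinuousOn (fun y : ℝ × ℝ => a y.1 y.2) D)
    (hb_cont : ContinuousOn (fun y : ℝ × ℝ => b y.1 y.2) D)
    (ha_pos : ∀ y ∈ D, 0 < a y.1 y.2) (hb_pos : ∀ y ∈ D, 0 < b y.1 y.2)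
    (h : IsClassicalSolution Ω Γ₁ Γ₂ Γ₃ D a b u₁ u₂ w₁ w₂ u w)
    (hU : ContDiffOn ℝ 1 U (Icc w₁ w₂))
    (huw : ∀ x ∈ closure Ω, w x ∈ Icc w₁ w₂ ∧ u x = U (w x)) :
    ∃ α β : ℝ → ℝ, Continuous α ∧ Continuous β ∧ (∀ t, 0 < β t) ∧
      (∀ t ∈ w '' closure Ω, β t = b (U t) t) ∧
      (∀ t ∈ w '' closure Ω, α t = a (U t) t * derivWithin U (Icc w₁ w₂) t) ∧
      (∀ x ∈ closure Ω, ∫ s in w₁..w x, β s = (∫ s in w₁..w₂, β s) * z x) ∧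
      ∀ x ∈ closure Ω, ∫ s in w₁..w x, α s = (∫ s in w₁..w₂, α s) * z x := by
  have hK : IsClosed (w '' closure Ω) :=
    (hΩ.isCompact_closure.image_of_continuousOn h.bc_w.continuousOn).isClosed
  have hKsub : w '' closure Ω ⊆ Icc w₁ w₂ := by
    rintro _ ⟨x, hx, rfl⟩
    exact (huw x hx).1
  have hKD : ∀ t ∈ w '' closure Ω, (U t, t) ∈ D := by
    rintro _ ⟨x, hx, rfl⟩
    rw [← (huw x hx).2]
    exact h.mem_domain x hx
  have hUc : ContinuousOn (fun t => (U t, t)) (w '' closure Ω) :=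
    (hU.continuousOn.mono hKsub).prodMk continuousOn_id
  obtain ⟨β, hβ, hβpos, hβK⟩ := exists_continuous_pos_eqOn hK
    (β := fun t => b (U t) t) (hb_cont.comp hUc hKD) (fun t ht => hb_pos _ (hKD t ht))
  obtain ⟨α, hα, -, hαK⟩ := exists_continuous_pos_eqOn hK
    (β := fun t => a (U t) t) (ha_cont.comp hUc hKD) (fun t ht => ha_pos _ (hKD t ht))
  have hU'c : ContinuousOn (derivWithin U (Icc w₁ w₂)) (Icc w₁ w₂) :=
    hU.continuousOn_derivWithin (uniqueDiffOn_Icc hw) le_rfl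
  have hU'pr : Continuous fun t => derivWithin U (Icc w₁ w₂) (projIcc w₁ w₂ hw.le t) :=
    hU'c.comp_continuous (by fun_prop) fun t => (projIcc w₁ w₂ hw.le t).2
  have hαU : ∀ t ∈ w '' closure Ω, α t * derivWithin U (Icc w₁ w₂) (projIcc w₁ w₂ hw.le t) =
      a (U t) t * derivWithin U (Icc w₁ w₂) t := fun t ht => by
    rw [hαK ht, projIcc_of_mem hw.le (hKsub ht)]
  refine ⟨fun t => α t * derivWithin U (Icc w₁ w₂) (projIcc w₁ w₂ hw.le t), β, hα.mul hU'pr, hβ,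
    hβpos, fun t ht => hβK ht, hαU, fun x hx => ?_, fun x hx => ?_⟩
  · refine hΩ.integral_eq_mul_of_flux hz hbc h.eq_w h.eq_w h.bc_w hβ (fun y hy => ?_) hx
    have hy' := subset_closure hy
    rw [hβK (mem_image_of_mem w hy'), (huw y hy').2]
  · refine hΩ.integral_eq_mul_of_flux hz hbc h.eq_u h.eq_w h.bc_w (hα.mul hU'pr)
      (fun y hy => ?_) hx
    have hy' := subset_closure hy
    have hUd : HasDerivWithinAt U (derivWithin U (Icc w₁ w₂) (w y)) (Icc w₁ w₂) (w y) :=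
      (hU.differentiableOn one_ne_zero _ (huw y hy').1).hasDerivWithinAt
    have hgrad := (h.eq_w.hasGradientAt hΩ.isOpen hy).comp_hasDerivWithinAt hUd (by
      filter_upwards [hΩ.isOpen.mem_nhds hy] with x hx using (huw x (subset_closure hx)).1)
    have hu : HasGradientAt u (derivWithin U (Icc w₁ w₂) (w y) • gradient w y) y :=
      hasGradientAt_iff_hasFDerivAt.2 ((hasGradientAt_iff_hasFDerivAt.1 hgrad).congr_of_eventuallyEq
        (by filter_upwards [hΩ.isOpen.mem_nhds hy] with x hx
              using (huw x (subset_closure hx)).2))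
    rw [Pi.mul_apply, hαU _ (mem_image_of_mem w hy'), hu.gradient, (huw y hy').2, mul_smul]

/-- Where `z` takes a Dirichlet value, so do `u` and `w`. -/
theorem IsClassicalSolution.eq_of_eq_zero_or_one (hΩ : MixedDomain Ω Γ₁ Γ₂ Γ₃)
    (hz : SolvesDivergenceEq Ω (fun _ => 1) z) (hbc : MixedBoundaryConditions Ω Γ₁ Γ₂ Γ₃ 0 1 z)
    (h : IsClassicalSolution Ω Γ₁ Γ₂ Γ₃ D a b u₁ u₂ w₁ w₂ u w)
    (huw : ∀ x ∈ closure Ω, w x ∈ Icc w₁ w₂ ∧ u x = U (w x)) {β : ℝ → ℝ} (hβ : Continuous β)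
    (hβpos : ∀ t, 0 < β t)
    (hβz : ∀ x ∈ closure Ω, ∫ s in w₁..w x, β s = (∫ s in w₁..w₂, β s) * z x)
    {x : EuclideanSpace ℝ (Fin N)} (hx : x ∈ closure Ω) :
    (z x = 0 → w x = w₁ ∧ U w₁ = u₁) ∧ (z x = 1 → w x = w₂ ∧ U w₂ = u₂) := by
  have hinj := (hβ.strictMono_integral hβpos w₁).injective
  refine ⟨fun h0 => ⟨hinj ?_, ?_⟩, fun h1 => ⟨hinj ?_, ?_⟩⟩
  · simp [hβz x hx, h0]
  · obtain ⟨y, hy⟩ := hΩ.nonempty₁_of_eq_zero hz hbc hx h0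
    have := (huw y (hΩ.boundary_subset_closure (Or.inl (Or.inl hy)))).2
    rw [h.bc_u.dirichlet₁ y hy, h.bc_w.dirichlet₁ y hy] at this
    exact this.symm
  · simp [hβz x hx, h1]
  · obtain ⟨y, hy⟩ := hΩ.nonempty₂_of_eq_one hz hbc hx h1
    have := (huw y (hΩ.boundary_subset_closure (Or.inl (Or.inr hy)))).2
    rw [h.bc_u.dirichlet₂ y hy, h.bc_w.dirichlet₂ y hy] at this
    exact this.symm

/-- If `z` takes all values in `[0, 1]`, then `w` takes all values in `[w₁, w₂]`. -/
theorem Icc_subset_image_of_integral_eq_mul (hw : w₁ < w₂) {β : ℝ → ℝ} (hβ : Continuous β)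
    (hβpos : ∀ t, 0 < β t)
    (hβz : ∀ x ∈ closure Ω, ∫ s in w₁..w x, β s = (∫ s in w₁..w₂, β s) * z x)
    (hrange : Icc (0 : ℝ) 1 ⊆ z '' closure Ω) : Icc w₁ w₂ ⊆ w '' closure Ω := by
  intro t ht
  have hmono := hβ.strictMono_integral hβpos w₁
  have h0 : 0 ≤ ∫ s in w₁..t, β s := by simpa using hmono.monotone ht.1
  have h1 : 0 < ∫ s in w₁..w₂, β s := by simpa using hmono hw
  have h2 : ∫ s in w₁..t, β s ≤ ∫ s in w₁..w₂, β s := hmono.monotone ht.2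
  obtain ⟨x, hx, hxz⟩ := hrange (show (∫ s in w₁..t, β s) / (∫ s in w₁..w₂, β s) ∈ Icc (0 : ℝ) 1
    from ⟨div_nonneg h0 h1.le, div_le_one_of_le₀ h2 h1.le⟩)
  refine ⟨x, hx, hmono.injective ?_⟩
  simp only [hβz x hx, hxz]
  field_simp

/-- If `w` takes all values in `[w₁, w₂]`, then `U` solves the differential equation
`U' = γ b(U, t) / a(U, t)` there. -/
theorem exists_hasDerivWithinAt_of_integral_eq_mul (hw : w₁ < w₂)
    (ha_pos : ∀ y ∈ D, 0 < a y.1 y.2)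
    (h : IsClassicalSolution Ω Γ₁ Γ₂ Γ₃ D a b u₁ u₂ w₁ w₂ u w)
    (hU : ContDiffOn ℝ 1 U (Icc w₁ w₂))
    (huw : ∀ x ∈ closure Ω, w x ∈ Icc w₁ w₂ ∧ u x = U (w x))
    {α β : ℝ → ℝ} (hα : Continuous α) (hβ : Continuous β) (hβpos : ∀ t, 0 < β t)
    (hβb : ∀ t ∈ w '' closure Ω, β t = b (U t) t)
    (hαa : ∀ t ∈ w '' closure Ω, α t = a (U t) t * derivWithin U (Icc w₁ w₂) t)
    (hβz : ∀ x ∈ closure Ω, ∫ s in w₁..w x, β s = (∫ s in w₁..w₂, β s) * z x)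
    (hαz : ∀ x ∈ closure Ω, ∫ s in w₁..w x, α s = (∫ s in w₁..w₂, α s) * z x)
    (himage : Icc w₁ w₂ ⊆ w '' closure Ω) :
    ∃ γ : ℝ, ∀ t ∈ Icc w₁ w₂, (U t, t) ∈ D ∧
      HasDerivWithinAt U (γ * (b (U t) t / a (U t) t)) (Icc w₁ w₂) t := by
  have hB : 0 < ∫ s in w₁..w₂, β s := by simpa using hβ.strictMono_integral hβpos w₁ hw
  set γ := (∫ s in w₁..w₂, α s) / ∫ s in w₁..w₂, β s with hγ
  have hprop : ∀ t ∈ Icc w₁ w₂, ∫ s in w₁..t, α s = γ * ∫ s in w₁..t, β s := by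
    intro t ht
    obtain ⟨x, hx, rfl⟩ := himage ht
    rw [hαz x hx, hβz x hx, hγ]
    field_simp
  refine ⟨γ, fun t ht => ?_⟩
  have hmemD : (U t, t) ∈ D := by
    obtain ⟨x, hx, rfl⟩ := himage ht
    rw [← (huw x hx).2]
    exact h.mem_domain x hx
  refine ⟨hmemD, ?_⟩
  have h1 : HasDerivWithinAt (fun t => ∫ s in w₁..t, α s) (α t) (Icc w₁ w₂) t :=
    (hα.hasDerivAt_integral w₁ t).hasDerivWithinAt
  have h2 : HasDerivWithinAt (fun t => ∫ s in w₁..t, α s) (γ * β t) (Icc w₁ w₂) t :=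
    ((hβ.hasDerivAt_integral w₁ t).const_mul γ).hasDerivWithinAt.congr hprop (hprop t ht)
  have h3 : α t = γ * β t := (uniqueDiffOn_Icc hw t ht).eq_deriv _ h1 h2
  rw [hαa t (himage ht), hβb t (himage ht)] at h3
  have ha := (ha_pos _ hmemD).ne'
  simp only at ha
  have h4 : γ * (b (U t) t / a (U t) t) = derivWithin U (Icc w₁ w₂) t := by
    rw [← mul_div_assoc, ← h3]
    field_simp
  rw [h4]
  exact (hU.differentiableOn one_ne_zero t ht).hasDerivWithinAt

/-- Uniqueness: the functions `U` of two functional solutions solve the same boundary value problem,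
and `U` determines `w` through the primitive of `b(U(t), t)`. -/
theorem IsFunctionalSolution.eqOn {u' w' : EuclideanSpace ℝ (Fin N) → ℝ}
    (hΩ : MixedDomain Ω Γ₁ Γ₂ Γ₃)
    (hz : SolvesDivergenceEq Ω (fun _ => 1) z) (hbc : MixedBoundaryConditions Ω Γ₁ Γ₂ Γ₃ 0 1 z)
    (hw : w₁ < w₂) (hD : uIcc u₁ u₂ ×ˢ Icc w₁ w₂ ⊆ D)
    (ha_cont : ContinuousOn (fun y : ℝ × ℝ => a y.1 y.2) D)
    (hb_cont : ContinuousOn (fun y : ℝ × ℝ => b y.1 y.2) D)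
    (ha_pos : ∀ y ∈ D, 0 < a y.1 y.2) (hb_pos : ∀ y ∈ D, 0 < b y.1 y.2) {L : ℝ}
    (hL : ∀ t ∈ Icc w₁ w₂, ∀ U ∈ uIcc u₁ u₂, ∀ V ∈ uIcc u₁ u₂,
      |b U t / a U t - b V t / a V t| ≤ L * |U - V|)
    (h : IsFunctionalSolution Ω Γ₁ Γ₂ Γ₃ D a b u₁ u₂ w₁ w₂ u w)
    (h' : IsFunctionalSolution Ω Γ₁ Γ₂ Γ₃ D a b u₁ u₂ w₁ w₂ u' w') :
    EqOn u u' (closure Ω) ∧ EqOn w w' (closure Ω) := by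
  obtain ⟨h, U, hU, huw⟩ := h
  obtain ⟨h', V, hV, huw'⟩ := h'
  obtain ⟨α, β, hα, hβ, hβpos, hβb, hαa, hβz, hαz⟩ :=
    h.exists_integral_eq_mul hΩ hz hbc hw ha_cont hb_cont ha_pos hb_pos hU huw
  obtain ⟨α', β', hα', hβ', hβpos', hβb', hαa', hβz', hαz'⟩ :=
    h'.exists_integral_eq_mul hΩ hz hbc hw ha_cont hb_cont ha_pos hb_pos hV huw'
  have hends := fun x hx => h.eq_of_eq_zero_or_one hΩ hz hbc huw hβ hβpos hβz (x := x) hx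
  have hends' := fun x hx => h'.eq_of_eq_zero_or_one hΩ hz hbc huw' hβ' hβpos' hβz' (x := x) hx
  rcases hΩ.range_mixedLaplace hz hbc with hrange | htriv
  · have himage := Icc_subset_image_of_integral_eq_mul hw hβ hβpos hβz hrange
    have himage' := Icc_subset_image_of_integral_eq_mul hw hβ' hβpos' hβz' hrange
    obtain ⟨γ, hγ⟩ := exists_hasDerivWithinAt_of_integral_eq_mul hw ha_pos h hU huw hα hβ hβpos
      hβb hαa hβz hαz himage
    obtain ⟨δ, hδ⟩ := exists_hasDerivWithinAt_of_integral_eq_mul hw ha_pos h' hV huw' hα' hβ'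
      hβpos' hβb' hαa' hβz' hαz' himage'
    obtain ⟨x₀, hx₀, hz₀⟩ := hrange (left_mem_Icc.2 zero_le_one)
    obtain ⟨x₁, hx₁, hz₁⟩ := hrange (right_mem_Icc.2 zero_le_one)
    have hU1 := ((hends x₀ hx₀).1 hz₀).2
    have hU2 := ((hends x₁ hx₁).2 hz₁).2
    have hV1 := ((hends' x₀ hx₀).1 hz₀).2
    have hV2 := ((hends' x₁ hx₁).2 hz₁).2
    have hpos : ∀ y ∈ D, 0 < b y.1 y.2 / a y.1 y.2 := fun y hy => div_pos (hb_pos y hy) (ha_pos y hy)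
    have hUI : ∀ t ∈ Icc w₁ w₂, U t ∈ uIcc u₁ u₂ := fun t ht => by
      have := mem_uIcc_of_hasDerivWithinAt (fun s hs => (hγ s hs).2)
        (fun s hs => (hpos _ (hγ s hs).1).le) ht
      rwa [hU1, hU2] at this
    have hVI : ∀ t ∈ Icc w₁ w₂, V t ∈ uIcc u₁ u₂ := fun t ht => by
      have := mem_uIcc_of_hasDerivWithinAt (fun s hs => (hδ s hs).2)
        (fun s hs => (hpos _ (hδ s hs).1).le) ht
      rwa [hV1, hV2] at this
    have hUV : EqOn U V (Icc w₁ w₂) := eqOn_of_hasDerivWithinAt_mul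
      (f := fun U t => b U t / a U t) hw hL (fun t ht y hy => hpos (y, t) (hD ⟨hy, ht⟩))
      (fun t ht => (hγ t ht).2) (fun t ht => (hδ t ht).2) hUI hVI (hU1.trans hV1.symm)
      (hU2.trans hV2.symm)
    have hββ' : EqOn β' β (Icc w₁ w₂) := fun t ht => by
      rw [hβb t (himage ht), hβb' t (himage' ht), hUV ht]
    have hint : ∀ t ∈ Icc w₁ w₂, ∫ s in w₁..t, β' s = ∫ s in w₁..t, β s := fun t ht =>
      intervalIntegral.integral_congr fun s hs => by
        rw [uIcc_of_le ht.1] at hs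
        exact hββ' ⟨hs.1, hs.2.trans ht.2⟩
    have hww' : EqOn w w' (closure Ω) := fun x hx => by
      refine (hβ.strictMono_integral hβpos w₁).injective ?_
      rw [hβz x hx, ← hint _ (huw' x hx).1, hβz' x hx, hint _ (right_mem_Icc.2 hw.le)]
    refine ⟨fun x hx => ?_, hww'⟩
    rw [(huw x hx).2, (huw' x hx).2, ← hww' hx, hUV (huw x hx).1]
  · have hboth : ∀ x ∈ closure Ω, u x = u' x ∧ w x = w' x := by
      intro x hx
      rw [(huw x hx).2, (huw' x hx).2]
      rcases htriv x hx with h0 | h1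
      · obtain ⟨e1, e2⟩ := (hends x hx).1 h0
        obtain ⟨e1', e2'⟩ := (hends' x hx).1 h0
        rw [e1, e1', e2, e2']
        exact ⟨rfl, rfl⟩
      · obtain ⟨e1, e2⟩ := (hends x hx).2 h1
        obtain ⟨e1', e2'⟩ := (hends' x hx).2 h1
        rw [e1, e1', e2, e2']
        exact ⟨rfl, rfl⟩
    exact ⟨fun x hx => (hboth x hx).1, fun x hx => (hboth x hx).2⟩

end

theorem mainTheorem1 {N : ℕ} (Ω Γ₁ Γ₂ Γ₃ : Set (EuclideanSpace ℝ (Fin N)))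
    (hΩ : MixedDomain Ω Γ₁ Γ₂ Γ₃) (hsolv : MixedLaplaceSolvable Ω Γ₁ Γ₂ Γ₃)
    (u₁ u₂ w₁ w₂ : ℝ) (hw : w₁ < w₂)
    -- the coefficients, defined on a set that contains the rectangle
    (D : Set (ℝ × ℝ)) (hD : uIcc u₁ u₂ ×ˢ Icc w₁ w₂ ⊆ D) (a b : ℝ → ℝ → ℝ)
    (ha_cont : ContinuousOn (fun y : ℝ × ℝ => a y.1 y.2) D)
    (hb_cont : ContinuousOn (fun y : ℝ × ℝ => b y.1 y.2) D)
    (ha_pos : ∀ y ∈ D, 0 < a y.1 y.2) (hb_pos : ∀ y ∈ D, 0 < b y.1 y.2)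
    (hab : ContDiffOn ℝ 1 (fun y : ℝ × ℝ => b y.1 y.2 / a y.1 y.2) (uIcc u₁ u₂ ×ˢ Icc w₁ w₂))
    (p q : ℝ → ℝ) (hp : IntegrableOn p (Icc w₁ w₂)) (hq : IntegrableOn q (Icc w₁ w₂))
    (hpq : ∀ᵐ t ∂(volume.restrict (Icc w₁ w₂)), 0 ≤ p t ∧
      ∀ U ∈ uIcc u₁ u₂, p t ≤ b U t / a U t ∧ b U t / a U t ≤ q t)
    (hp_pos : 0 < ∫ t in w₁..w₂, p t) :
    (∃ u w : EuclideanSpace ℝ (Fin N) → ℝ,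
      IsFunctionalSolution Ω Γ₁ Γ₂ Γ₃ D a b u₁ u₂ w₁ w₂ u w) ∧
    ((∃ L : ℝ, ∀ t ∈ Icc w₁ w₂, ∀ U ∈ uIcc u₁ u₂, ∀ V ∈ uIcc u₁ u₂,
        |b U t / a U t - b V t / a V t| ≤ L * |U - V|) →
      ∀ u w u' w' : EuclideanSpace ℝ (Fin N) → ℝ,
        IsFunctionalSolution Ω Γ₁ Γ₂ Γ₃ D a b u₁ u₂ w₁ w₂ u w →
        IsFunctionalSolution Ω Γ₁ Γ₂ Γ₃ D a b u₁ u₂ w₁ w₂ u' w' →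
        EqOn u u' (closure Ω) ∧ EqOn w w' (closure Ω)) := by
  obtain ⟨z, hharm, hbc⟩ := hsolv
  have hz := hharm.solvesDivergenceEq
  refine ⟨exists_isFunctionalSolution hΩ hz hbc hw hD hb_cont ha_pos hb_pos hab, ?_⟩
  rintro ⟨L, hL⟩ u w u' w' h h'
  exact h.eqOn hΩ hz hbc hw hD ha_cont hb_cont ha_pos hb_pos hL h'
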